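/- For real $q$ with $0<|q|<1$ let $\mathcal H=\ell^2(\mathbb N)\otimes\ell^2(\mathbb Z)$ with canonical orthonormal basis $(\xi_{n,k})_{n\ge 0,\,k\in\mathbb Z}$ (and $\xi_{-1,k}=0$), and let $C(SU_q(2))$ be the unital C$^*$-algebra of operators on $\mathcal H$ generated by $$a\,\xi_{n,k}=\sqrt{1-q^{2n}}\;\xi_{n-1,k},\qquad b\,\xi_{n,k}=q^n\,\xi_{n,k+1},$$ with its invariant (Haar) state $\varphi(x)=(1-q^2)\sum_{n\ge 0}q^{2n}\langle x\,\xi_{n,0},\xi_{n,0}\rangle$. Let $e_{mn}\in C(SU_q(2))$ be the matrix units $e_{mn}\xi_{r,k}=\delta_{r,n}\xi_{m,k}$, and put $p=e_{00}$ and $w=e_{01}+e_{12}+e_{20}+\sum_{k\ge 3}e_{kk}$ (a unitary). Let $(q_k)_{k\ge 1}$ be a sequence of reals with $0<|q_k|<1$ and $\sum_k q_k^2<\infty$, and write $\varphi_k,p_k,w_k$ for the above objects for $q=q_k$. Let $\mathscr L^2(SU_{q_k}(2))$ be the GNS Hilbert space of $\varphi_k$ with cyclic vector $\xi_k$, and let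 $$M=\mathscr L^\infty(SU_{\mathbf q}(2))=\bigotimes_{k=1}^\infty\big(\mathscr L^\infty(SU_{q_k}(2)),\varphi_k\big)$$ be the von Neumann algebra on $\bigotimes_k(\mathscr L^2(SU_{q_k}(2)),\xi_k)$ generated by the GNS images of the algebras $C(SU_{q_k}(2))$ acting in the respective tensor factors. For $n\ge 0$ let $$\theta_n=\Big(\prod_{k=1}^n q_k^{-2}\Big)\Big(\bigotimes_{k=1}^n\varphi_k(w_k^*\,\cdot\,w_k)\Big)\otimes\Big(\bigotimes_{k=n+1}^\infty\varphi_k\Big),$$ a normal positive functional on $M$. Then: 1. For every $x\in M^+$ the sequence $(\theta_n(x))_n$ is increasing; put $\varphi_\Omega(x)=\lim_n\theta_n(x)=\sup_n\theta_n(x)\in[0,\infty]$. 2. $\varphi_\Omega$ is a weight on $M$ which is normal, faithful, not finite, and semi-finite (the linear span of $\{x\in M^+:\varphi_\Omega(x)<\infty\}$ is $\sigma$-weakly dense in $M$). 3. For every $n\ge 0$ the operators $1\otimes\big(\bigotimes_{k=n+1}^{n+m}p_k\big)\otimes 1$ converge $\sigma$-strongly, as $m\to\infty$, to a projection $s_n=1\otimes\big(\bigotimes_{k=n+1}^{\infty}p_k\big)\in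 M$; one has $\varphi_\Omega(s_n)<\infty$ for all $n$, and $s_n\to 1$ $\sigma$-strongly as $n\to\infty$. -/

import Mathlib

noncomputable section

open scoped ComplexOrder InnerProductSpace

namespace QSU2

/-- The weighted composition operator `(T x) i = c i * x (σ i)` on `ℓ²(ι)`. -/
def weightedComp {ι : Type*} (c : ι → ℂ) (σ : ι → ι) (hc : ∀ i, ‖c i‖ ≤ 1)
    (hσ : Set.InjOn σ (Function.support c)) :
    lp (fun _ : ι => ℂ) 2 →L[ℂ] lp (fun _ : ι => ℂ) 2 :=
  have key : ∀ (x : lp (fun _ : ι => ℂ) 2) (s : Finset ι),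
      ∑ i ∈ s, ‖c i * x (σ i)‖ ^ (2 : ENNReal).toReal ≤ ‖x‖ ^ (2 : ENNReal).toReal := by
    classical
    intro x s
    calc ∑ i ∈ s, ‖c i * x (σ i)‖ ^ (2 : ENNReal).toReal
        = ∑ i ∈ s with c i ≠ 0, ‖c i * x (σ i)‖ ^ (2 : ENNReal).toReal := by
          refine (Finset.sum_filter_of_ne (p := fun i => c i ≠ 0) fun i _ h h0 => h ?_).symm
          simp [h0]
      _ ≤ ∑ i ∈ s with c i ≠ 0, ‖x (σ i)‖ ^ (2 : ENNReal).toReal := by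
          refine Finset.sum_le_sum fun i _ => ?_
          gcongr
          rw [norm_mul]
          exact mul_le_of_le_one_left (norm_nonneg _) (hc i)
      _ = ∑ j ∈ (s.filter fun i => c i ≠ 0).image σ, ‖x j‖ ^ (2 : ENNReal).toReal := by
          rw [Finset.sum_image]
          intro i hi j hj h
          simp only [Finset.coe_filter, Set.mem_ofPred_eq] at hi hj
          exact hσ hi.2 hj.2 h
      _ ≤ _ := lp.sum_rpow_le_norm_rpow (by simp) x _
  LinearMap.mkContinuous
    { toFun := fun x => ⟨fun i => c i * x (σ i), memℓp_gen' (key x)⟩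
      map_add' := fun x y => by ext i; exact mul_add _ _ _
      map_smul' := fun r x => by ext i; exact mul_left_comm _ _ _ }
    1 (fun x => by
      rw [one_mul]
      exact lp.norm_le_of_forall_sum_le (by simp) (norm_nonneg _) (key x))

@[simp]
theorem weightedComp_apply {ι : Type*} (c : ι → ℂ) (σ : ι → ι) (hc hσ)
    (x : lp (fun _ : ι => ℂ) 2) (i : ι) : weightedComp c σ hc hσ x i = c i * x (σ i) := rfl

/-- The admissible deformation parameters: `q` real with `0 < |q| < 1`. -/
abbrev Param := {q : ℝ // 0 < |q| ∧ |q| < 1}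

/-- The Hilbert space `ℓ²(ℕ) ⊗ ℓ²(ℤ) = ℓ²(ℕ × ℤ)`. -/
abbrev Hilb := lp (fun _ : ℕ × ℤ => ℂ) 2

/-- The canonical orthonormal basis `ξ_{n,k}` of `ℓ²(ℕ × ℤ)`. -/
def basisVec (n : ℕ) (k : ℤ) : Hilb := lp.single 2 (n, k) 1

theorem Param.sq_pow_le (q : Param) (m : ℕ) : (q : ℝ) ^ (2 * m) ≤ 1 := by
  rw [pow_mul, ← sq_abs]
  exact pow_le_one₀ (by positivity) (pow_le_one₀ (abs_nonneg _) q.2.2.le)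

/-- The operator `a`, with `a ξ_{n,k} = √(1 - q^{2n}) ξ_{n-1,k}`. -/
def opA (q : Param) : Hilb →L[ℂ] Hilb :=
  weightedComp (fun i => (Real.sqrt (1 - (q : ℝ) ^ (2 * (i.1 + 1))) : ℂ))
    (fun i => (i.1 + 1, i.2))
    (fun i => by
      rw [Complex.norm_real, Real.norm_of_nonneg (Real.sqrt_nonneg _)]
      refine Real.sqrt_le_one.mpr ?_
      have : 0 ≤ (q : ℝ) ^ (2 * (i.1 + 1)) := by rw [pow_mul]; positivity
      linarith)
    (fun i _ j _ h => by
      simp only [Prod.mk.injEq, add_left_inj] at h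
      exact Prod.ext h.1 h.2)

/-- The operator `b`, with `b ξ_{n,k} = q^n ξ_{n,k+1}`. -/
def opB (q : Param) : Hilb →L[ℂ] Hilb :=
  weightedComp (fun i => ((q : ℝ) : ℂ) ^ i.1) (fun i => (i.1, i.2 - 1))
    (fun i => by
      rw [norm_pow, Complex.norm_real]
      exact pow_le_one₀ (norm_nonneg _) q.2.2.le)
    (fun i _ j _ h => by
      simp only [Prod.mk.injEq, sub_left_inj] at h
      exact Prod.ext h.1 h.2)

/-- The matrix units `f_{m,n}`, with `f_{m,n} ξ_{r,k} = δ_{r,n} ξ_{m,k}`. -/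
def matUnit (m n : ℕ) : Hilb →L[ℂ] Hilb :=
  weightedComp (fun i => if i.1 = m then 1 else 0) (fun i => (n, i.2))
    (fun i => by split_ifs <;> simp)
    (fun i hi j hj h => by
      simp only [Function.mem_support, ne_eq, ite_eq_right_iff, one_ne_zero, imp_false,
        not_not] at hi hj
      simp only [Prod.mk.injEq, true_and] at h
      exact Prod.ext (hi.trans hj.symm) h)

theorem opA_apply (q : Param) (x : Hilb) (n : ℕ) (k : ℤ) :
    opA q x (n, k) = (Real.sqrt (1 - (q : ℝ) ^ (2 * (n + 1))) : ℂ) * x (n + 1, k) := rfl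

theorem opB_apply (q : Param) (x : Hilb) (n : ℕ) (k : ℤ) :
    opB q x (n, k) = ((q : ℝ) : ℂ) ^ n * x (n, k - 1) := rfl

theorem matUnit_apply (m n : ℕ) (x : Hilb) (r : ℕ) (k : ℤ) :
    matUnit m n x (r, k) = (if r = m then 1 else 0) * x (n, k) := rfl

theorem basisVec_apply (n : ℕ) (k : ℤ) (r : ℕ) (l : ℤ) :
    basisVec n k (r, l) = if r = n ∧ l = k then 1 else 0 := by
  simp [basisVec, Pi.single_apply, Prod.ext_iff]

theorem smul_hilb_apply (c : ℂ) (x : Hilb) (r : ℕ) (l : ℤ) : (c • x) (r, l) = c * x (r, l) := rfl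

theorem inner_basisVec (x : Hilb) (n : ℕ) (k : ℤ) : ⟪basisVec n k, x⟫_ℂ = x (n, k) := by
  rw [basisVec, lp.inner_single_left]
  simp

theorem opA_basisVec_succ (q : Param) (n : ℕ) (k : ℤ) :
    opA q (basisVec (n + 1) k)
      = (Real.sqrt (1 - (q : ℝ) ^ (2 * (n + 1))) : ℂ) • basisVec n k := by
  ext ⟨r, l⟩
  rw [opA_apply, smul_hilb_apply, basisVec_apply, basisVec_apply]
  by_cases h : r = n
  · subst h; simp
  · simp [h]

theorem opA_basisVec_zero (q : Param) (k : ℤ) : opA q (basisVec 0 k) = 0 := by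
  ext ⟨r, l⟩
  rw [opA_apply, basisVec_apply]
  simp

theorem opB_basisVec (q : Param) (n : ℕ) (k : ℤ) :
    opB q (basisVec n k) = ((q : ℝ) : ℂ) ^ n • basisVec n (k + 1) := by
  ext ⟨r, l⟩
  rw [opB_apply, smul_hilb_apply, basisVec_apply, basisVec_apply]
  by_cases h : r = n
  · subst h; simp [sub_eq_iff_eq_add]
  · simp [h]

theorem matUnit_basisVec (m n r : ℕ) (k : ℤ) :
    matUnit m n (basisVec r k) = if r = n then basisVec m k else 0 := by
  ext ⟨s, l⟩
  rw [matUnit_apply, basisVec_apply]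
  split_ifs with h1 h2 h3 h3 <;> simp_all [basisVec_apply]

theorem opA_star_apply_succ (q : Param) (x : Hilb) (n : ℕ) (k : ℤ) :
    (star (opA q) : Hilb →L[ℂ] Hilb) x (n + 1, k)
      = (Real.sqrt (1 - (q : ℝ) ^ (2 * (n + 1))) : ℂ) * x (n, k) := by
  rw [← inner_basisVec, ContinuousLinearMap.star_eq_adjoint,
    ContinuousLinearMap.adjoint_inner_right, opA_basisVec_succ, inner_smul_left, inner_basisVec,
    Complex.conj_ofReal]

theorem opA_star_apply_zero (q : Param) (x : Hilb) (k : ℤ) :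
    (star (opA q) : Hilb →L[ℂ] Hilb) x (0, k) = 0 := by
  rw [← inner_basisVec, ContinuousLinearMap.star_eq_adjoint,
    ContinuousLinearMap.adjoint_inner_right, opA_basisVec_zero, inner_zero_left]

theorem opB_star_apply (q : Param) (x : Hilb) (n : ℕ) (k : ℤ) :
    (star (opB q) : Hilb →L[ℂ] Hilb) x (n, k) = ((q : ℝ) : ℂ) ^ n * x (n, k + 1) := by
  rw [← inner_basisVec, ContinuousLinearMap.star_eq_adjoint,
    ContinuousLinearMap.adjoint_inner_right, opB_basisVec, inner_smul_left, inner_basisVec,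
    map_pow, Complex.conj_ofReal]

theorem sqrt_mul_sqrt (q : Param) (n : ℕ) :
    (Real.sqrt (1 - (q : ℝ) ^ (2 * n)) : ℂ) * (Real.sqrt (1 - (q : ℝ) ^ (2 * n)) : ℂ)
      = 1 - ((q : ℝ) : ℂ) ^ (2 * n) := by
  rw [← Complex.ofReal_mul, Real.mul_self_sqrt (by linarith [q.sq_pow_le n])]
  push_cast
  rfl

/-- The defining relations of `Pol(SU_q(2))` hold for the operators `a` and `b`. -/
theorem relations (q : Param) :
    star (opA q) * opA q + star (opB q) * opB q = 1 ∧
    opA q * star (opA q) + (((q : ℝ) : ℂ) ^ 2) • (opB q * star (opB q)) = 1 ∧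
    opB q * star (opB q) = star (opB q) * opB q ∧
    opA q * opB q = ((q : ℝ) : ℂ) • (opB q * opA q) ∧
    star (opA q) * opB q = ((q : ℝ) : ℂ)⁻¹ • (opB q * star (opA q)) := by
  have hq : ((q : ℝ) : ℂ) ≠ 0 := by
    have := q.2.1
    simpa [abs_pos] using this
  refine ⟨?_, ?_, ?_, ?_, ?_⟩ <;> ext x ⟨n, k⟩
  · change (star (opA q) : Hilb →L[ℂ] Hilb) (opA q x) (n, k)
      + (star (opB q) : Hilb →L[ℂ] Hilb) (opB q x) (n, k) = x (n, k)
    rw [opB_star_apply, opB_apply]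
    cases n with
    | zero => rw [opA_star_apply_zero]; simp
    | succ n =>
      rw [opA_star_apply_succ, opA_apply, ← mul_assoc, sqrt_mul_sqrt]
      simp only [add_sub_cancel_right]; ring
  · change opA q ((star (opA q) : Hilb →L[ℂ] Hilb) x) (n, k)
      + ((q : ℝ) : ℂ) ^ 2 * opB q ((star (opB q) : Hilb →L[ℂ] Hilb) x) (n, k) = x (n, k)
    rw [opB_apply, opB_star_apply, opA_apply, opA_star_apply_succ, ← mul_assoc, sqrt_mul_sqrt]
    simp only [sub_add_cancel]; ring
  · change opB q ((star (opB q) : Hilb →L[ℂ] Hilb) x) (n, k)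
      = (star (opB q) : Hilb →L[ℂ] Hilb) (opB q x) (n, k)
    rw [opB_apply, opB_star_apply, opB_star_apply, opB_apply]
    simp
  · change opA q (opB q x) (n, k) = ((q : ℝ) : ℂ) * opB q (opA q x) (n, k)
    rw [opA_apply, opB_apply, opB_apply, opA_apply]
    ring
  · change (star (opA q) : Hilb →L[ℂ] Hilb) (opB q x) (n, k)
      = ((q : ℝ) : ℂ)⁻¹ * opB q ((star (opA q) : Hilb →L[ℂ] Hilb) x) (n, k)
    rw [opB_apply]
    cases n with
    | zero => rw [opA_star_apply_zero, opA_star_apply_zero]; simp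
    | succ n =>
      rw [opA_star_apply_succ, opA_star_apply_succ, opB_apply]
      field_simp
      ring

/-- The C*-algebra `C(SU_q(2))`, in its canonical faithful representation: the norm closure of the
unital *-algebra generated by `a` and `b`. -/
def cAlg (q : Param) : StarSubalgebra ℂ (Hilb →L[ℂ] Hilb) :=
  (StarAlgebra.adjoin ℂ {opA q, opB q}).topologicalClosure

theorem opA_mem (q : Param) : opA q ∈ cAlg q :=
  StarSubalgebra.le_topologicalClosure _ (StarAlgebra.subset_adjoin ℂ _ (by simp))

theorem opB_mem (q : Param) : opB q ∈ cAlg q :=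
  StarSubalgebra.le_topologicalClosure _ (StarAlgebra.subset_adjoin ℂ _ (by simp))

theorem isClosed_cAlg (q : Param) : IsClosed (cAlg q : Set (Hilb →L[ℂ] Hilb)) :=
  StarSubalgebra.isClosed_topologicalClosure _

theorem matUnit_zero_mem (q : Param) : matUnit 0 0 ∈ cAlg q := by
  have hpow : ∀ (m : ℕ) (x : Hilb) (n : ℕ) (k : ℤ),
      ((star (opB q) * opB q : Hilb →L[ℂ] Hilb) ^ m) x (n, k)
        = ((q : ℝ) : ℂ) ^ (2 * n * m) * x (n, k) := by
    intro m
    induction m with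
    | zero => intro x n k; simp
    | succ m ih =>
      intro x n k
      rw [pow_succ]
      change ((star (opB q) * opB q : Hilb →L[ℂ] Hilb) ^ m)
        ((star (opB q) : Hilb →L[ℂ] Hilb) (opB q x)) (n, k) = _
      rw [ih, opB_star_apply, opB_apply]
      simp only [add_sub_cancel_right]; ring
  have hq0 : (0 : ℝ) ≤ (q : ℝ) ^ 2 := by positivity
  have hq1 : (q : ℝ) ^ 2 < 1 := by
    rw [← sq_abs]; exact pow_lt_one₀ (abs_nonneg _) q.2.2 two_ne_zero
  refine (isClosed_cAlg q).mem_of_tendsto (b := Filter.atTop)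
    (f := fun m : ℕ => (star (opB q) * opB q : Hilb →L[ℂ] Hilb) ^ m) ?_
    (Filter.Eventually.of_forall fun m =>
      pow_mem (mul_mem (star_mem (opB_mem q)) (opB_mem q)) m)
  rw [tendsto_iff_norm_sub_tendsto_zero]
  refine squeeze_zero (fun _ => norm_nonneg _) (fun m => ?_)
    (tendsto_pow_atTop_nhds_zero_of_lt_one hq0 hq1)
  refine ContinuousLinearMap.opNorm_le_bound _ (by positivity) fun x => ?_
  have : ‖((((q : ℝ) ^ 2) ^ m : ℝ) : ℂ) • x‖ = ((q : ℝ) ^ 2) ^ m * ‖x‖ := by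
    rw [norm_smul, Complex.norm_real, Real.norm_of_nonneg (by positivity)]
  rw [← this]
  refine lp.norm_mono (by simp) ?_
  rintro ⟨n, k⟩
  change ‖((star (opB q) * opB q : Hilb →L[ℂ] Hilb) ^ m) x (n, k) - matUnit 0 0 x (n, k)‖
    ≤ ‖((((q : ℝ) ^ 2) ^ m : ℝ) : ℂ) * x (n, k)‖
  rw [hpow, matUnit_apply]
  cases n with
  | zero => simp; positivity
  | succ n =>
    simp only [Nat.add_eq_zero_iff, one_ne_zero, and_false, if_false, zero_mul, sub_zero, norm_mul]
    refine mul_le_mul_of_nonneg_right ?_ (norm_nonneg _)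
    rw [norm_pow, Complex.norm_real, Complex.norm_real, Real.norm_eq_abs, Real.norm_eq_abs,
      abs_pow, abs_pow, ← pow_mul]
    exact pow_le_pow_of_le_one (abs_nonneg _) q.2.2.le (by nlinarith [Nat.zero_le (n * m)])

theorem sqrt_ne_zero (q : Param) (n : ℕ) :
    (Real.sqrt (1 - (q : ℝ) ^ (2 * (n + 1))) : ℂ) ≠ 0 := by
  rw [Complex.ofReal_ne_zero, Real.sqrt_ne_zero']
  have : (q : ℝ) ^ (2 * (n + 1)) < 1 := by
    rw [pow_mul, ← sq_abs]
    exact pow_lt_one₀ (by positivity) (pow_lt_one₀ (abs_nonneg _) q.2.2 two_ne_zero) (by omega)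
  linarith

theorem matUnit_mem (q : Param) (m n : ℕ) : matUnit m n ∈ cAlg q := by
  induction n with
  | zero =>
    induction m with
    | zero => exact matUnit_zero_mem q
    | succ m ih =>
      have h : matUnit (m + 1) 0 = (Real.sqrt (1 - (q : ℝ) ^ (2 * (m + 1))) : ℂ)⁻¹ •
          (star (opA q) * matUnit m 0) := by
        rw [eq_inv_smul_iff₀ (sqrt_ne_zero q m)]
        ext x ⟨r, k⟩
        change _ * matUnit (m + 1) 0 x (r, k)
          = (star (opA q) : Hilb →L[ℂ] Hilb) (matUnit m 0 x) (r, k)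
        cases r with
        | zero => rw [opA_star_apply_zero, matUnit_apply]; simp
        | succ r =>
          rw [opA_star_apply_succ, matUnit_apply, matUnit_apply]
          by_cases hr : r = m
          · subst hr; simp
          · simp [hr]
      rw [h]
      exact (cAlg q).smul_mem (mul_mem (star_mem (opA_mem q)) ih) _
  | succ n ih =>
    have h : matUnit m (n + 1) = (Real.sqrt (1 - (q : ℝ) ^ (2 * (n + 1))) : ℂ)⁻¹ •
        (matUnit m n * opA q) := by
      rw [eq_inv_smul_iff₀ (sqrt_ne_zero q n)]
      ext x ⟨r, k⟩
      change _ * matUnit m (n + 1) x (r, k) = matUnit m n (opA q x) (r, k)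
      rw [matUnit_apply, matUnit_apply, opA_apply]
      ring
    rw [h]
    exact (cAlg q).smul_mem (mul_mem ih (opA_mem q)) _

/-- The C*-algebra `C(SU_q(2))` as a type. -/
def CSU (q : Param) : Type := cAlg q

instance (q : Param) : CStarAlgebra (CSU q) :=
  haveI : IsClosed (cAlg q : Set (Hilb →L[ℂ] Hilb)) := isClosed_cAlg q
  inferInstanceAs (CStarAlgebra (cAlg q))

instance (q : Param) : PartialOrder (CSU q) := CStarAlgebra.spectralOrder (CSU q)

instance (q : Param) : StarOrderedRing (CSU q) := CStarAlgebra.spectralOrderedRing (CSU q)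

/-- The canonical faithful representation `π` of `C(SU_q(2))` on `ℓ²(ℕ × ℤ)`. -/
def rep (q : Param) : CSU q →⋆ₐ[ℂ] (Hilb →L[ℂ] Hilb) := (cAlg q).subtype

/-- The matrix units `e_{m,n}` of `C(SU_q(2))`. -/
def unitE (q : Param) (m n : ℕ) : CSU q := ⟨matUnit m n, matUnit_mem q m n⟩

/-- The projection `p = e_{00}`. -/
def projP (q : Param) : CSU q := unitE q 0 0

/-- The unitary `w = e_{01} + e_{12} + e_{20} + ∑_{k ≥ 3} e_{kk}`; the last (strongly convergent)
sum is `1 - e_{00} - e_{11} - e_{22}`. -/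
def unitW (q : Param) : CSU q :=
  unitE q 0 1 + unitE q 1 2 + unitE q 2 0 + (1 - unitE q 0 0 - unitE q 1 1 - unitE q 2 2)

theorem basisVec_norm (n : ℕ) (k : ℤ) : ‖basisVec n k‖ = 1 := by
  simp [basisVec, lp.norm_single]

theorem haar_summable (q : Param) (x : Hilb →L[ℂ] Hilb) :
    Summable fun n : ℕ => ((q : ℝ) : ℂ) ^ (2 * n) * ⟪basisVec n 0, x (basisVec n 0)⟫_ℂ := by
  have hq1 : (q : ℝ) ^ 2 < 1 := by
    rw [← sq_abs]; exact pow_lt_one₀ (abs_nonneg _) q.2.2 two_ne_zero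
  refine Summable.of_norm_bounded (g := fun n => ((q : ℝ) ^ 2) ^ n * ‖x‖)
    ((summable_geometric_of_lt_one (by positivity) hq1).mul_right _) fun n => ?_
  rw [norm_mul, norm_pow, Complex.norm_real, Real.norm_eq_abs, pow_mul, sq_abs]
  gcongr
  refine (norm_inner_le_norm _ _).trans ?_
  rw [basisVec_norm, one_mul]
  refine (x.le_opNorm _).trans ?_
  rw [basisVec_norm, mul_one]

/-- The invariant state of `C(SU_q(2))`:
`φ(x) = (1 - q²) ∑ₙ q^{2n} ⟨π(x) ξ_{n,0}, ξ_{n,0}⟩`. -/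
def haar (q : Param) : CSU q →ₚ[ℂ] ℂ :=
  PositiveLinearMap.mk₀
    { toFun := fun x => (1 - ((q : ℝ) : ℂ) ^ 2) *
        ∑' n : ℕ, ((q : ℝ) : ℂ) ^ (2 * n) * ⟪basisVec n 0, rep q x (basisVec n 0)⟫_ℂ
      map_add' := fun x y => by
        rw [← mul_add, ← (haar_summable q _).tsum_add (haar_summable q _)]
        congr 2 with n
        rw [map_add, add_apply, inner_add_right, mul_add]
      map_smul' := fun c x => by
        have h : ∀ n : ℕ, ((q : ℝ) : ℂ) ^ (2 * n) * ⟪basisVec n 0, rep q (c • x) (basisVec n 0)⟫_ℂ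
            = c * (((q : ℝ) : ℂ) ^ (2 * n) * ⟪basisVec n 0, rep q x (basisVec n 0)⟫_ℂ) :=
          fun n => by
            rw [map_smul, smul_apply, inner_smul_right, mul_left_comm]
        rw [tsum_congr h, tsum_mul_left, RingHom.id_apply, smul_eq_mul, mul_left_comm] }
    (fun x hx => by
      obtain ⟨y, rfl⟩ := CStarAlgebra.nonneg_iff_eq_star_mul_self.mp hx
      have hq1 : (q : ℝ) ^ 2 ≤ 1 := q.sq_pow_le 1
      refine mul_nonneg ?_ (tsum_nonneg fun n => mul_nonneg ?_ ?_)
      · rw [← Complex.ofReal_pow, ← Complex.ofReal_one, ← Complex.ofReal_sub,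
          Complex.zero_le_real]
        linarith
      · rw [← Complex.ofReal_pow, Complex.zero_le_real, pow_mul]
        positivity
      · rw [map_mul, map_star, mul_apply_eq_comp, ContinuousLinearMap.star_eq_adjoint,
          ContinuousLinearMap.adjoint_inner_right]
        rw [inner_self_eq_norm_sq_to_K]
        positivity)

theorem haar_apply (q : Param) (x : CSU q) : haar q x = (1 - ((q : ℝ) : ℂ) ^ 2) *
    ∑' n : ℕ, ((q : ℝ) : ℂ) ^ (2 * n) * ⟪basisVec n 0, rep q x (basisVec n 0)⟫_ℂ := rfl

theorem haar_one (q : Param) : haar q 1 = 1 := by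
  have hq1 : (q : ℝ) ^ 2 < 1 := by
    rw [← sq_abs]; exact pow_lt_one₀ (abs_nonneg _) q.2.2 two_ne_zero
  have h : ∀ n : ℕ, ((q : ℝ) : ℂ) ^ (2 * n) * ⟪basisVec n 0, rep q 1 (basisVec n 0)⟫_ℂ
      = (((q : ℝ) : ℂ) ^ 2) ^ n := fun n => by
    rw [map_one, one_apply_eq_self, inner_self_eq_norm_sq_to_K, basisVec_norm, pow_mul]
    simp
  have hn : ‖((q : ℝ) : ℂ) ^ 2‖ < 1 := by
    rw [norm_pow, Complex.norm_real, Real.norm_eq_abs, sq_abs]; exact hq1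
  rw [haar_apply, tsum_congr h, tsum_geometric_of_norm_lt_one hn]
  refine mul_inv_cancel₀ fun h0 => ?_
  rw [← sub_eq_zero.mp h0, norm_one] at hn
  exact lt_irrefl _ hn

/-- The Hilbert space `L²(SU_q(2))` of the GNS construction for the invariant state. -/
abbrev L2 (q : Param) : Type := (haar q).GNS

/-- The GNS representation of `C(SU_q(2))` on `L²(SU_q(2))`. -/
def gnsRep (q : Param) : CSU q →⋆ₐ[ℂ] (L2 q →L[ℂ] L2 q) := (haar q).gnsStarAlgHom

/-- The cyclic GNS vector of the invariant state. -/
def gnsVec (q : Param) : L2 q := ((haar q).toPreGNS 1 : (haar q).PreGNS)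

theorem inner_gnsRep (q : Param) (x y : CSU q) :
    ⟪gnsRep q x (gnsVec q), gnsRep q y (gnsVec q)⟫_ℂ = haar q (star x * y) := by
  have h : ∀ z : CSU q, gnsRep q z (gnsVec q)
      = (((haar q).toPreGNS z : (haar q).PreGNS) : L2 q) := fun z => by
    change (haar q).gnsNonUnitalStarAlgHom z (gnsVec q) = _
    rw [gnsVec, PositiveLinearMap.gnsNonUnitalStarAlgHom_apply_coe,
      PositiveLinearMap.leftMulMapPreGNS_apply]
    simp
  rw [h, h, UniformSpace.Completion.inner_coe]
  rfl

theorem gnsVec_norm (q : Param) : ‖gnsVec q‖ = 1 := by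
  have h := inner_gnsRep q 1 1
  rw [map_one, one_apply_eq_self, star_one, one_mul, haar_one] at h
  rw [@norm_eq_sqrt_re_inner ℂ, h]
  simp

end QSU2

namespace InfTensor

theorem posSemidef_finprod {X ι : Type*} (G : ι → Matrix X X ℂ) (hG : ∀ i, (G i).PosSemidef)
    (hf : ∀ x y, (Function.mulSupport fun i => G i x y).Finite) :
    Matrix.PosSemidef (Matrix.of fun x y => ∏ᶠ i, G i x y : Matrix X X ℂ) := by
  classical
  have hfin : ∀ F : Finset ι,
      Matrix.PosSemidef (Matrix.of fun x y => ∏ i ∈ F, G i x y : Matrix X X ℂ) := by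
    intro F
    induction F using Finset.induction_on with
    | empty =>
      refine ⟨by ext x y; simp, fun c => ?_⟩
      have : (c.sum fun i xi => c.sum fun j xj =>
          star xi * (Matrix.of fun x y => ∏ i ∈ (∅ : Finset ι), G i x y : Matrix X X ℂ) i j * xj)
          = star (∑ i ∈ c.support, c i) * ∑ i ∈ c.support, c i := by
        simp [Finsupp.sum, Finset.sum_mul_sum]
      rw [this]
      exact star_mul_self_nonneg _
    | insert i F hi ih =>
      have : (Matrix.of fun x y => ∏ i ∈ insert i F, G i x y : Matrix X X ℂ)
          = Matrix.hadamard (G i) (Matrix.of fun x y => ∏ i ∈ F, G i x y) := by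
        ext x y; simp [Finset.prod_insert hi]
      rw [this]
      exact (hG i).hadamard ih
  have hloc : ∀ s : Finset X, ∃ F : Finset ι, ∀ x ∈ s, ∀ y ∈ s,
      ∏ᶠ i, G i x y = ∏ i ∈ F, G i x y := by
    intro s
    refine ⟨s.biUnion fun x => s.biUnion fun y => (hf x y).toFinset, fun x hx y hy => ?_⟩
    refine finprod_eq_prod_of_mulSupport_subset _ fun i hi => ?_
    simp only [Finset.coe_biUnion, Set.mem_iUnion]
    exact ⟨x, hx, y, hy, by simpa using hi⟩
  refine ⟨?_, fun c => ?_⟩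
  · ext x y
    obtain ⟨F, hF⟩ := hloc {x, y}
    have h := congrFun (congrFun (hfin F).1 x) y
    simp only [Matrix.conjTranspose_apply, Matrix.of_apply] at h ⊢
    rw [hF y (by simp) x (by simp), hF x (by simp) y (by simp)]
    exact h
  · obtain ⟨F, hF⟩ := hloc c.support
    refine ((hfin F).2 c).trans_eq ?_
    refine Finset.sum_congr rfl fun x hx => Finset.sum_congr rfl fun y hy => ?_
    simp only [Matrix.of_apply]
    rw [hF x hx y hy]

theorem posSemidef_form {X V W : Type*} [NormedAddCommGroup V] [InnerProductSpace ℂ V]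
    [NormedAddCommGroup W] [InnerProductSpace ℂ W] (u : X → V) (T : V →L[ℂ] W) (c : ℝ)
    (hc : ‖T‖ ^ 2 ≤ c) :
    Matrix.PosSemidef
      (Matrix.of fun x y => (c : ℂ) * ⟪u x, u y⟫_ℂ - ⟪T (u x), T (u y)⟫_ℂ : Matrix X X ℂ) := by
  refine ⟨by ext x y; simp, fun f => ?_⟩
  set v : V := ∑ x ∈ f.support, f x • u x with hv
  have : (f.sum fun i xi => f.sum fun j xj => star xi *
      (Matrix.of fun x y => (c : ℂ) * ⟪u x, u y⟫_ℂ - ⟪T (u x), T (u y)⟫_ℂ : Matrix X X ℂ) i j * xj)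
      = ((c * ‖v‖ ^ 2 - ‖T v‖ ^ 2 : ℝ) : ℂ) := by
    have h1 : ((‖v‖ ^ 2 : ℝ) : ℂ) = ⟪v, v⟫_ℂ := by
      rw [inner_self_eq_norm_sq_to_K]; simp
    have h2 : ((‖T v‖ ^ 2 : ℝ) : ℂ) = ⟪T v, T v⟫_ℂ := by
      rw [inner_self_eq_norm_sq_to_K]; simp
    rw [Complex.ofReal_sub, Complex.ofReal_mul, h1, h2, hv, map_sum]
    simp only [Finsupp.sum, sum_inner, inner_sum, map_smul, inner_smul_left, inner_smul_right,
      Matrix.of_apply, Finset.mul_sum, ← Finset.sum_sub_distrib]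
    rw [Finset.sum_comm]
    refine Finset.sum_congr rfl fun x _ => Finset.sum_congr rfl fun y _ => ?_
    simp only [RCLike.star_def]
    ring
  rw [this, Complex.zero_le_real, sub_nonneg]
  calc ‖T v‖ ^ 2 ≤ (‖T‖ * ‖v‖) ^ 2 := by gcongr; exact T.le_opNorm v
    _ = ‖T‖ ^ 2 * ‖v‖ ^ 2 := by ring
    _ ≤ _ := by gcongr

section

variable {ι : Type*} {H : ι → Type*} [∀ i, NormedAddCommGroup (H i)]
  [∀ i, InnerProductSpace ℂ (H i)]

/-- The families `(x_i)` of vectors with `x_i = ξ_i` for all but finitely many `i`. -/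
def Elem (ξ : ∀ i, H i) : Type _ := {x : ∀ i, H i // {i | x i ≠ ξ i}.Finite}

/-- The inner product `∏_i ⟨x_i, y_i⟩` of two elementary tensors. -/
def kernel (ξ : ∀ i, H i) : Matrix (Elem ξ) (Elem ξ) ℂ :=
  Matrix.of fun x y => ∏ᶠ i, ⟪x.1 i, y.1 i⟫_ℂ

theorem finite_mulSupport {ξ : ∀ i, H i} (hξ : ∀ i, ‖ξ i‖ = 1) (x y : Elem ξ) :
    (Function.mulSupport fun i => ⟪x.1 i, y.1 i⟫_ℂ).Finite := by
  refine (x.2.union y.2).subset fun i hi => ?_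
  by_contra h
  simp only [Set.mem_union, Set.mem_ofPred_eq, not_or, not_not] at h
  refine hi ?_
  simp only [h.1, h.2]
  rw [inner_self_eq_norm_sq_to_K, hξ]
  simp

theorem kernel_posSemidef {ξ : ∀ i, H i} (hξ : ∀ i, ‖ξ i‖ = 1) : (kernel ξ).PosSemidef := by
  refine posSemidef_finprod (fun i => Matrix.of fun x y : Elem ξ => ⟪x.1 i, y.1 i⟫_ℂ) (fun i => ?_)
    (finite_mulSupport hξ)
  have := posSemidef_form (fun x : Elem ξ => x.1 i) (0 : H i →L[ℂ] H i) 1 (by simp)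
  simpa using this

/-- The sesquilinear extension of `⟨⊗ x_i, ⊗ y_i⟩ = ∏_i ⟨x_i, y_i⟩` to finite formal linear
combinations of elementary tensors. -/
def form (ξ : ∀ i, H i) (f g : Elem ξ →₀ ℂ) : ℂ :=
  f.sum fun x a => g.sum fun y b => star a * kernel ξ x y * b

theorem form_conj_symm {ξ : ∀ i, H i} (hξ : ∀ i, ‖ξ i‖ = 1) (f g : Elem ξ →₀ ℂ) :
    starRingEnd ℂ (form ξ g f) = form ξ f g := by
  rw [form, form, Finsupp.sum_comm]
  simp only [map_finsuppSum]
  refine Finset.sum_congr rfl fun x _ => Finset.sum_congr rfl fun y _ => ?_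
  have h := congrFun (congrFun (kernel_posSemidef hξ).1 x) y
  rw [Matrix.conjTranspose_apply] at h
  dsimp only
  rw [← h]
  simp [mul_comm, mul_left_comm]

theorem form_add_left (ξ : ∀ i, H i) (f g h : Elem ξ →₀ ℂ) :
    form ξ (f + g) h = form ξ f h + form ξ g h := by
  rw [form, form, form, Finsupp.sum_add_index']
  · simp
  · intro x a b
    rw [← Finsupp.sum_add]
    simp [add_mul]

theorem form_smul_left (ξ : ∀ i, H i) (f g : Elem ξ →₀ ℂ) (r : ℂ) :
    form ξ (r • f) g = starRingEnd ℂ r * form ξ f g := by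
  rw [form, form, Finsupp.sum_smul_index (by simp), Finsupp.mul_sum]
  refine Finset.sum_congr rfl fun x _ => ?_
  dsimp only
  rw [Finsupp.mul_sum]
  refine Finset.sum_congr rfl fun y _ => ?_
  simp [mul_assoc]

set_option linter.unusedVariables false in
/-- The space of finite formal linear combinations of elementary tensors, as a semi-inner product
space. -/
def Pre (ξ : ∀ i, H i) (hξ : ∀ i, ‖ξ i‖ = 1) : Type _ := Elem ξ →₀ ℂ

variable (ξ : ∀ i, H i) (hξ : ∀ i, ‖ξ i‖ = 1)

instance : AddCommGroup (Pre ξ hξ) := inferInstanceAs (AddCommGroup (Elem ξ →₀ ℂ))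
instance : Module ℂ (Pre ξ hξ) := inferInstanceAs (Module ℂ (Elem ξ →₀ ℂ))

/-- The identification of `Pre` with the formal linear combinations. -/
def toPre : (Elem ξ →₀ ℂ) ≃ₗ[ℂ] Pre ξ hξ := LinearEquiv.refl ℂ _

/-- The semi-inner product given by `form`. -/
abbrev preCore : PreInnerProductSpace.Core ℂ (Pre ξ hξ) where
  inner f g := form ξ ((toPre ξ hξ).symm f) ((toPre ξ hξ).symm g)
  conj_inner_symm f g := form_conj_symm hξ _ _
  re_inner_nonneg f := (RCLike.nonneg_iff.mp ((kernel_posSemidef hξ).2 ((toPre ξ hξ).symm f))).1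
  add_left f g h := by rw [map_add]; exact form_add_left ξ _ _ _
  smul_left f g r := by rw [map_smul]; exact form_smul_left ξ _ _ _

instance : SeminormedAddCommGroup (Pre ξ hξ) :=
  InnerProductSpace.Core.toSeminormedAddCommGroup (c := preCore ξ hξ)

instance : InnerProductSpace ℂ (Pre ξ hξ) := InnerProductSpace.ofCore (preCore ξ hξ)

/-- The infinite tensor product `⊗_i (H_i, ξ_i)` of Hilbert spaces with distinguished unit
vectors: the Hilbert space completion of the span of the elementary tensors. -/
abbrev Tensor : Type _ := UniformSpace.Completion (Pre ξ hξ)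

theorem pre_inner_def (f g : Pre ξ hξ) :
    ⟪f, g⟫_ℂ = form ξ ((toPre ξ hξ).symm f) ((toPre ξ hξ).symm g) := rfl

variable {ξ}

/-- The elementary tensor `⊗_i x_i`. -/
def tprod (x : Elem ξ) : Tensor ξ hξ := (toPre ξ hξ (Finsupp.single x 1) : Pre ξ hξ)

theorem inner_tprod (x y : Elem ξ) :
    ⟪tprod hξ x, tprod hξ y⟫_ℂ = ∏ᶠ i, ⟪x.1 i, y.1 i⟫_ℂ := by
  rw [tprod, tprod, UniformSpace.Completion.inner_coe, pre_inner_def, LinearEquiv.symm_apply_apply,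
    LinearEquiv.symm_apply_apply, form, Finsupp.sum_single_index, Finsupp.sum_single_index] <;>
  simp [kernel]

theorem form_mapDomain (u : Elem ξ → Elem ξ) (f : Elem ξ →₀ ℂ) :
    form ξ (f.mapDomain u) (f.mapDomain u)
      = f.sum fun x a => f.sum fun y b => star a * kernel ξ (u x) (u y) * b := by
  rw [form, Finsupp.sum_mapDomain_index (by simp)
    (fun x a b => by rw [← Finsupp.sum_add]; simp [add_mul])]
  refine Finset.sum_congr rfl fun x _ => ?_
  dsimp only
  rw [Finsupp.sum_mapDomain_index (by simp) (fun y a b => by rw [mul_add])]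

variable [DecidableEq ι]

/-- Replace the `i`-th entry of an elementary tensor. -/
def Elem.update (x : Elem ξ) (i : ι) (v : H i) : Elem ξ :=
  ⟨Function.update x.1 i v, (x.2.insert i).subset fun j hj => by
    by_cases h : j = i
    · exact Or.inl h
    · refine Or.inr ?_
      simpa [Function.update_of_ne h] using hj⟩

/-- Apply an operator to the `i`-th entry of an elementary tensor. -/
def Elem.act (i : ι) (T : H i →L[ℂ] H i) (x : Elem ξ) : Elem ξ := x.update i (T (x.1 i))

theorem Elem.act_same (i : ι) (T : H i →L[ℂ] H i) (x : Elem ξ) : (x.act i T).1 i = T (x.1 i) :=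
  Function.update_self _ _ _

theorem Elem.act_ne (i : ι) (T : H i →L[ℂ] H i) (x : Elem ξ) {j : ι} (h : j ≠ i) :
    (x.act i T).1 j = x.1 j :=
  Function.update_of_ne h _ _

theorem posSemidef_act (hξ : ∀ i, ‖ξ i‖ = 1) (i : ι) (T : H i →L[ℂ] H i) :
    Matrix.PosSemidef (Matrix.of fun x y : Elem ξ => ((‖T‖ ^ 2 : ℝ) : ℂ) * kernel ξ x y
      - kernel ξ (x.act i T) (y.act i T)) := by
  have hfin : ∀ x y : Elem ξ, (Function.mulSupport fun j =>
      (if j = i then ((‖T‖ ^ 2 : ℝ) : ℂ) * ⟪x.1 j, y.1 j⟫_ℂ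
        - ⟪(x.act i T).1 j, (y.act i T).1 j⟫_ℂ else ⟪x.1 j, y.1 j⟫_ℂ)).Finite := fun x y => by
    refine ((finite_mulSupport hξ x y).insert i).subset fun j hj => ?_
    by_cases h : j = i
    · exact Or.inl h
    · refine Or.inr ?_
      simpa [h] using hj
  have key := posSemidef_finprod (fun j => Matrix.of fun x y : Elem ξ =>
      (if j = i then ((‖T‖ ^ 2 : ℝ) : ℂ) * ⟪x.1 j, y.1 j⟫_ℂ
        - ⟪(x.act i T).1 j, (y.act i T).1 j⟫_ℂ else ⟪x.1 j, y.1 j⟫_ℂ)) (fun j => ?_) hfin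
  · convert key using 1
    ext x y
    simp only [Matrix.of_apply, kernel]
    set F := insert i ((finite_mulSupport hξ x y).toFinset) with hF
    have hi : i ∈ F := Finset.mem_insert_self _ _
    have hout : ∀ j, j ∉ F → ⟪x.1 j, y.1 j⟫_ℂ = 1 := fun j hj => by
      by_contra h
      exact hj (Finset.mem_insert_of_mem (by simpa using h))
    have hne : ∀ j, j ∉ F → j ≠ i := fun j hj h => hj (h ▸ hi)
    rw [finprod_eq_prod_of_mulSupport_subset (s := F), finprod_eq_prod_of_mulSupport_subset (s := F),
      finprod_eq_prod_of_mulSupport_subset (s := F), ← Finset.mul_prod_erase F _ hi,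
      ← Finset.mul_prod_erase F _ hi, ← Finset.mul_prod_erase F _ hi, if_pos rfl]
    · have h1 : ∏ j ∈ F.erase i, ⟪(x.act i T).1 j, (y.act i T).1 j⟫_ℂ
          = ∏ j ∈ F.erase i, ⟪x.1 j, y.1 j⟫_ℂ := Finset.prod_congr rfl fun j hj => by
        rw [Elem.act_ne i T x (Finset.ne_of_mem_erase hj),
          Elem.act_ne i T y (Finset.ne_of_mem_erase hj)]
      have h2 : ∏ j ∈ F.erase i, (if j = i then ((‖T‖ ^ 2 : ℝ) : ℂ) * ⟪x.1 j, y.1 j⟫_ℂ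
          - ⟪(x.act i T).1 j, (y.act i T).1 j⟫_ℂ else ⟪x.1 j, y.1 j⟫_ℂ)
          = ∏ j ∈ F.erase i, ⟪x.1 j, y.1 j⟫_ℂ := Finset.prod_congr rfl fun j hj =>
        if_neg (Finset.ne_of_mem_erase hj)
      rw [h1, h2]
      ring
    all_goals
      intro j hj
      by_contra h
      refine hj ?_
      have h0 := hout j h
      have h1 := hne j h
      simp only [h1, if_false]
      try rw [Elem.act_ne i T x h1, Elem.act_ne i T y h1]
      exact h0
  · by_cases h : j = i
    · subst h
      have := posSemidef_form (fun x : Elem ξ => x.1 j) T (‖T‖ ^ 2) le_rfl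
      convert this using 1
      ext x y
      simp only [Matrix.of_apply, if_true, Elem.act_same]
    · have := posSemidef_form (fun x : Elem ξ => x.1 j) (0 : H j →L[ℂ] H j) 1 (by simp)
      convert this using 1
      ext x y
      simp [h]

/-- The operator `1 ⊗ T ⊗ 1` on elementary tensors, with `T` in the `i`-th place. -/
def preLeg (i : ι) (T : H i →L[ℂ] H i) : Pre ξ hξ →L[ℂ] Pre ξ hξ :=
  LinearMap.mkContinuous
    ((toPre ξ hξ).toLinearMap ∘ₗ Finsupp.lmapDomain ℂ ℂ (Elem.act i T) ∘ₗ
      (toPre ξ hξ).symm.toLinearMap) ‖T‖ (fun f => by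
    have hn : ∀ g : Pre ξ hξ, ((‖g‖ ^ 2 : ℝ) : ℂ)
        = form ξ ((toPre ξ hξ).symm g) ((toPre ξ hξ).symm g) := fun g => by
      rw [← pre_inner_def, inner_self_eq_norm_sq_to_K]; simp
    rw [← sq_le_sq₀ (norm_nonneg _) (by positivity), mul_pow, ← Complex.real_le_real,
      Complex.ofReal_mul, hn, hn, ← sub_nonneg]
    refine ((posSemidef_act hξ i T).2 ((toPre ξ hξ).symm f)).trans_eq ?_
    simp only [LinearMap.comp_apply, LinearEquiv.coe_coe, LinearEquiv.symm_apply_apply,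
      Finsupp.lmapDomain_apply]
    rw [form_mapDomain, form]
    simp only [Finsupp.sum, Finset.mul_sum, ← Finset.sum_sub_distrib, Matrix.of_apply]
    refine Finset.sum_congr rfl fun x _ => Finset.sum_congr rfl fun y _ => ?_
    ring)

/-- The operator `1 ⊗ T ⊗ 1` on the infinite tensor product, with `T` in the `i`-th place. -/
def leg (i : ι) (T : H i →L[ℂ] H i) : Tensor ξ hξ →L[ℂ] Tensor ξ hξ :=
  (preLeg hξ i T).completion

theorem leg_tprod (i : ι) (T : H i →L[ℂ] H i) (x : Elem ξ) :
    leg hξ i T (tprod hξ x) = tprod hξ (x.act i T) := by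
  rw [leg, tprod, ContinuousLinearMap.completion_apply_coe, tprod]
  congr 1
  change toPre ξ hξ (Finsupp.mapDomain (Elem.act i T) (Finsupp.single x 1)) = _
  rw [Finsupp.mapDomain_single]

end

end InfTensor

namespace OpAlg

open scoped ENNReal NNReal Topology

variable {E : Type*} [NormedAddCommGroup E] [InnerProductSpace ℂ E] [CompleteSpace E]

/-- The von Neumann algebra generated by a set of operators: the double commutant of the set
together with its adjoints. -/
def generated (S : Set (E →L[ℂ] E)) : VonNeumannAlgebra E where
  toStarSubalgebra := StarSubalgebra.centralizer ℂ (StarSubalgebra.centralizer ℂ S : Set (E →L[ℂ] E))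
  centralizer_centralizer' := by
    simp

/-- The positive cone `M⁺`, with the operator order. -/
abbrev PosCone (M : VonNeumannAlgebra E) : Type _ := {x : E →L[ℂ] E // x ∈ M ∧ 0 ≤ x}

/-- `x_j → y` in the `σ`-strong topology: `∑ᵢ ‖(x_j - y) ηᵢ‖² → 0` for every square summable
sequence of vectors. -/
def SigmaStrongTendsto {α : Type*} (x : α → E →L[ℂ] E) (l : Filter α) (y : E →L[ℂ] E) : Prop :=
  ∀ η : ℕ → E, (Summable fun i => ‖η i‖ ^ 2) →
    Filter.Tendsto (fun j => ∑' i, ‖(x j - y) (η i)‖ ^ 2) l (𝓝 0)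

/-- The `σ`-weak topology on `B(E)`, induced by the functionals `x ↦ ∑ᵢ ⟨ηᵢ, x ζᵢ⟩` with `η`, `ζ`
square summable. -/
abbrev sigmaWeak (E : Type*) [NormedAddCommGroup E] [InnerProductSpace ℂ E] :
    TopologicalSpace (E →L[ℂ] E) :=
  ⨅ (η : ℕ → E) (ζ : ℕ → E) (_ : Summable fun i => ‖η i‖ ^ 2) (_ : Summable fun i => ‖ζ i‖ ^ 2),
    TopologicalSpace.induced (fun x => ∑' i, ⟪η i, x (ζ i)⟫_ℂ) inferInstance

variable {M : VonNeumannAlgebra E}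

/-- A weight on `M`: an additive, positively homogeneous map `M⁺ → [0, ∞]` (with `0 · ∞ = 0`). -/
structure IsWeight (φ : PosCone M → ℝ≥0∞) : Prop where
  map_add : ∀ x y z : PosCone M, z.1 = x.1 + y.1 → φ z = φ x + φ y
  map_smul : ∀ (r : ℝ≥0) (x z : PosCone M), z.1 = ((r : ℝ) : ℂ) • x.1 → φ z = r * φ x

/-- Normality: `φ(sup x_i) = sup φ(x_i)` for bounded increasing nets in `M⁺`. -/
def IsNormal (φ : PosCone M → ℝ≥0∞) : Prop :=
  ∀ D : Set (PosCone M), D.Nonempty → DirectedOn (· ≤ ·) D → ∀ x, IsLUB D x → φ x = ⨆ y ∈ D, φ y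

/-- Faithfulness: `φ(x) = 0` only for `x = 0`. -/
def IsFaithful (φ : PosCone M → ℝ≥0∞) : Prop := ∀ x : PosCone M, φ x = 0 → x.1 = 0

/-- Finiteness: `φ(x) < ∞` for all `x ∈ M⁺`. -/
def IsFinite (φ : PosCone M → ℝ≥0∞) : Prop := ∀ x : PosCone M, φ x < ∞

/-- The space `𝓜_φ` of integrable elements: the linear span of the positive `x` with
`φ(x) < ∞`. -/
def integrableSpan (φ : PosCone M → ℝ≥0∞) : Submodule ℂ (E →L[ℂ] E) :=
  Submodule.span ℂ {x | ∃ y : PosCone M, φ y < ∞ ∧ y.1 = x}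

/-- Semi-finiteness: the integrable elements are `σ`-weakly dense in `M`. -/
def IsSemifinite (φ : PosCone M → ℝ≥0∞) : Prop :=
  (M : Set (E →L[ℂ] E)) ⊆ @closure _ (sigmaWeak E) (integrableSpan φ : Set (E →L[ℂ] E))

end OpAlg

namespace QSU2

open scoped ENNReal NNReal
open InfTensor

variable (q : ℕ → Param)

/-- The GNS space of the invariant state `φ_𝐪 = ⊗_k φ_k`, that is `⊗_k (L²(SU_{q_k}(2)), ξ_k)`. -/
abbrev L2Inf : Type := Tensor (fun k => gnsVec (q k)) (fun k => gnsVec_norm (q k))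

/-- The element `x ∈ C(SU_{q_k}(2))` acting in the `k`-th tensor factor. -/
def legRep (k : ℕ) (x : CSU (q k)) : L2Inf q →L[ℂ] L2Inf q :=
  leg (fun k => gnsVec_norm (q k)) k (gnsRep (q k) x)

/-- The von Neumann algebra `L^∞(SU_𝐪(2)) = ⊗_k L^∞(SU_{q_k}(2))`. -/
def LInf : VonNeumannAlgebra (L2Inf q) :=
  OpAlg.generated {T | ∃ (k : ℕ) (x : CSU (q k)), T = legRep q k x}

/-- The finite elementary tensor `1 ⊗ x_n ⊗ x_{n+1} ⊗ ⋯ ⊗ x_{n+m-1} ⊗ 1` (tensor factors are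
numbered from `0`). -/
def finTensor (x : ∀ k, CSU (q k)) (n m : ℕ) : L2Inf q →L[ℂ] L2Inf q :=
  ((List.range m).map fun j => legRep q (n + j) (x (n + j))).prod

/-- The vector `(⊗_{k<n} w_k ξ_k) ⊗ (⊗_{k≥n} ξ_k)`. -/
def twistedVec (n : ℕ) : Elem (fun k => gnsVec (q k)) :=
  ⟨fun k => if k < n then gnsRep (q k) (unitW (q k)) (gnsVec (q k)) else gnsVec (q k),
    (Set.finite_lt_nat n).subset fun k hk => by
      by_contra h
      exact hk (if_neg h)⟩

/-- The normal state `(⊗_{k<n} φ_k(w_k^* · w_k)) ⊗ (⊗_{k≥n} φ_k)`. As `φ_k(w_k^* · w_k)` and `φ_k`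
are the vector states of `w_k ξ_k` and `ξ_k`, it is the vector state of the elementary tensor of
these vectors. -/
def twistedState (n : ℕ) (x : L2Inf q →L[ℂ] L2Inf q) : ℂ :=
  ⟪tprod (fun k => gnsVec_norm (q k)) (twistedVec q n),
    x (tprod (fun k => gnsVec_norm (q k)) (twistedVec q n))⟫_ℂ

/-- `(∏_{k<n} q_k^{-2}) (⊗_{k<n} φ_k(w_k^* · w_k)) ⊗ (⊗_{k≥n} φ_k)` on `L^∞(SU_𝐪(2))⁺`. -/
def rescaled (n : ℕ) (x : OpAlg.PosCone (LInf q)) : ℝ≥0∞ :=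
  ENNReal.ofReal ((∏ k ∈ Finset.range n, ((q k : ℝ) ^ 2)⁻¹) * (twistedState q n x.1).re)

/-- The weight `φ_Ω`. -/
def weightOmega (x : OpAlg.PosCone (LInf q)) : ℝ≥0∞ := ⨆ n, rescaled q n x

theorem finTensor_tprod (x : ∀ k, CSU (q k)) (m : ℕ) (v : Elem (fun k => gnsVec (q k))) :
    ∃ u : Elem (fun k => gnsVec (q k)),
      (∀ k, u.1 k = if k < m then gnsRep (q k) (x k) (v.1 k) else v.1 k) ∧
      finTensor q x 0 m (tprod (fun k => gnsVec_norm (q k)) v)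
        = tprod (fun k => gnsVec_norm (q k)) u := by
  induction m generalizing v with
  | zero => exact ⟨v, by simp, by simp [finTensor]⟩
  | succ m ih =>
    obtain ⟨u, hu, hu'⟩ := ih (v.act m (gnsRep (q m) (x m)))
    refine ⟨u, fun k => ?_, ?_⟩
    · rw [hu]
      rcases lt_trichotomy k m with h | h | h
      · rw [if_pos h, if_pos (by omega), Elem.act_ne _ _ _ h.ne]
      · subst h
        rw [if_neg (lt_irrefl _), if_pos (by omega), Elem.act_same]
      · rw [if_neg (by omega), if_neg (by omega), Elem.act_ne _ _ _ h.ne']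
    · rw [← hu', finTensor, finTensor, List.range_succ, List.map_append, List.prod_append,
        List.map_singleton, List.prod_singleton, mul_apply_eq_comp]
      congr 1
      have : legRep q (0 + m) (x (0 + m)) = legRep q m (x m) := by rw [zero_add]
      rw [this, legRep, leg_tprod]

/-- On elementary tensors, `twistedState` is the product of the states in the factors. -/
theorem twistedState_finTensor (x : ∀ k, CSU (q k)) (n m : ℕ) (hnm : n ≤ m) :
    twistedState q n (finTensor q x 0 m)
      = (∏ k ∈ Finset.range n, haar (q k) (star (unitW (q k)) * x k * unitW (q k)))
        * ∏ k ∈ Finset.Ico n m, haar (q k) (x k) := by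
  obtain ⟨u, hu, hu'⟩ := finTensor_tprod q x m (twistedVec q n)
  rw [twistedState, hu', inner_tprod, finprod_eq_prod_of_mulSupport_subset (s := Finset.range m),
    ← Finset.prod_range_mul_prod_Ico _ hnm]
  · congr 1
    · refine Finset.prod_congr rfl fun k hk => ?_
      rw [Finset.mem_range] at hk
      rw [hu, if_pos (by omega)]
      simp only [twistedVec, if_pos hk]
      rw [← mul_apply_eq_comp, ← map_mul, inner_gnsRep, mul_assoc]
    · refine Finset.prod_congr rfl fun k hk => ?_
      rw [Finset.mem_Ico] at hk
      rw [hu, if_pos (by omega)]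
      simp only [twistedVec, if_neg (not_lt.mpr hk.1)]
      have := inner_gnsRep (q k) 1 (x k)
      rwa [map_one, one_apply_eq_self, star_one, one_mul] at this
  · intro k hk
    by_contra h
    simp only [Finset.coe_range, Set.mem_Iio, not_lt] at h
    refine hk ?_
    simp only [hu, if_neg (not_lt.mpr h)]
    simp only [twistedVec, if_neg (not_lt.mpr (hnm.trans h))]
    rw [inner_self_eq_norm_sq_to_K, gnsVec_norm]
    simp

end QSU2

end

open scoped ComplexOrder InnerProductSpace

/-! ### Strong limits, normality and semi-finiteness for operators on a Hilbert space. -/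

namespace OpAlg

open scoped ENNReal NNReal Topology

variable {E : Type*} [NormedAddCommGroup E] [InnerProductSpace ℂ E]

/-! Up to its prefactor, `θ_n` is the vector state of `Ω_n = (⊗_{k<n} w_k ξ_k) ⊗ (⊗_{k≥n} ξ_k)`, and
every claim about it is read off from this vector (tensor factors are numbered from `0`).

Monotonicity comes from the domination `φ ≤ q⁻² φ(w^* · w)` in one factor. Right multiplication by
`w^*` extends to an operator `T` on the GNS space that commutes with the algebra and sends `w ξ` to
`ξ`. Since `w^*` permutes the levels `n` of `ℓ²(ℕ)` and raises a level by at most one, it changes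
the Haar weights `q^{2n}` by a factor at most `q⁻²`, whence `‖T‖² ≤ q⁻²` (`exists_commutant_unitW`).
Placed in leg `n`, `T` lies in the commutant of `M` and maps `Ω_{n+1}` to `Ω_n`, so `θ_n ≤ θ_{n+1}`
(`rescaled_le_succ`). An increasing supremum of normal positive functionals is a normal weight.

Faithfulness already holds for `θ_0`. Right multiplication by any polynomial in `a`, `b` and their
adjoints is bounded on the GNS space, so `ξ_k` is cyclic for the commutant in each leg. Hence `⊗
ξ_k` is separating for `M` (`dense_commutant_gnsVec`, `eq_zero_of_commute_leg`). The weight is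
infinite because `θ_n(1) = ∏_{k<n} q_k⁻²` diverges.

For semi-finiteness, `φ_k(w_k^* p_k w_k) = (1 - q_k²) q_k²` cancels the factor `q_k⁻²` of the
normalisation up to `1 - q_k² ≤ 1`, so `φ_Ω(s_n) ≤ ∏_{k<n} q_k⁻²` (`weightOmega_lt_top_of_le`).
Since `φ_k(1 - p_k) = q_k²` is summable, a union bound gives `s_n → 1` (`tendsto_infinite_projP`).
The compressions `s_n x s_n ≤ ‖x‖ s_n` are then integrable and approximate `x`. -/

theorem inner_re_mono {x y : E →L[ℂ] E} (h : x ≤ y) (η : E) :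
    (⟪η, x η⟫_ℂ).re ≤ (⟪η, y η⟫_ℂ).re := by
  have := ((ContinuousLinearMap.le_def x y).mp h).re_inner_nonneg_right η
  simpa [inner_sub_right] using this

theorem inner_re_nonneg {x : E →L[ℂ] E} (h : 0 ≤ x) (η : E) : 0 ≤ (⟪η, x η⟫_ℂ).re := by
  simpa using inner_re_mono h η

theorem tendsto_inner_re {α : Type*} {l : Filter α} {y : α → E →L[ℂ] E} {z : E →L[ℂ] E}
    (hz : ∀ η, Filter.Tendsto (fun i => y i η) l (𝓝 (z η))) (η : E) :
    Filter.Tendsto (fun i => (⟪η, y i η⟫_ℂ).re) l (𝓝 (⟪η, z η⟫_ℂ).re) :=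
  (Complex.continuous_re.tendsto _).comp (tendsto_const_nhds.inner (hz η))

/-- For uniformly bounded nets, strong convergence implies `σ`-strong convergence. -/
theorem sigmaStrongTendsto_of_strong {α : Type*} {l : Filter α} {y : α → E →L[ℂ] E}
    {z : E →L[ℂ] E} {C : ℝ} (hC : ∀ i, ‖y i - z‖ ≤ C)
    (hz : ∀ η, Filter.Tendsto (fun i => y i η) l (𝓝 (z η))) : SigmaStrongTendsto y l z := by
  intro η hη
  have h := tendsto_tsum_of_dominated_convergence (𝓕 := l)
    (f := fun j i => ‖(y j - z) (η i)‖ ^ 2) (g := fun _ => (0 : ℝ))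
    (bound := fun i => C ^ 2 * ‖η i‖ ^ 2) (hη.mul_left _) (fun i => ?_)
    (Filter.Eventually.of_forall fun j i => ?_)
  · simpa using h
  · have := (((hz (η i)).sub_const (z (η i))).norm).pow 2
    simpa using this
  · rw [Real.norm_of_nonneg (by positivity), ← mul_pow]
    gcongr
    exact (y j - z).le_of_opNorm_le (hC j) _

theorem summable_norm_mul_norm {V : Type*} [SeminormedAddCommGroup V] {η ζ : ℕ → V} (hη : Summable fun i => ‖η i‖ ^ 2)
    (hζ : Summable fun i => ‖ζ i‖ ^ 2) : Summable fun i => ‖η i‖ * ‖ζ i‖ := by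
  refine Summable.of_nonneg_of_le (fun i => by positivity) (fun i => ?_) (hη.add hζ)
  nlinarith [sq_nonneg (‖η i‖ - ‖ζ i‖), sq_nonneg (‖η i‖), sq_nonneg (‖ζ i‖)]

variable [CompleteSpace E]

/-- This is `d² ≤ ‖d‖ d`: the product of the commuting positive operators `d` and `‖d‖ - d` is
positive. It turns control of quadratic forms into control of norms. -/
theorem norm_apply_sq_le {d : E →L[ℂ] E} (hd : 0 ≤ d) (η : E) :
    ‖d η‖ ^ 2 ≤ ‖d‖ * (⟪η, d η⟫_ℂ).re := by
  have hsa : IsSelfAdjoint d := .of_nonneg hd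
  have h1 : 0 ≤ algebraMap ℝ (E →L[ℂ] E) ‖d‖ - d := sub_nonneg.mpr hsa.le_algebraMap_norm_self
  have h2 : 0 ≤ d * (algebraMap ℝ (E →L[ℂ] E) ‖d‖ - d) :=
    Commute.mul_nonneg hd h1 ((Algebra.commute_algebraMap_right ‖d‖ d).sub_right (Commute.refl d))
  have h3 := inner_re_nonneg h2 η
  have h4 : ⟪η, d (d η)⟫_ℂ = ((‖d η‖ ^ 2 : ℝ) : ℂ) := by
    rw [← ContinuousLinearMap.adjoint_inner_left, ← ContinuousLinearMap.star_eq_adjoint,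
      hsa.star_eq, inner_self_eq_norm_sq_to_K]
    simp
  rw [mul_sub, sub_apply, inner_sub_right, mul_apply_eq_comp, mul_apply_eq_comp, h4,
    Algebra.algebraMap_eq_smul_one, smul_apply, one_apply_eq_self,
    ContinuousLinearMap.map_smul_of_tower, ← Complex.coe_smul, inner_smul_right, Complex.sub_re,
    Complex.re_ofReal_mul, Complex.ofReal_re] at h3
  linarith

theorem apply_eq_zero_of_inner_eq_zero {d : E →L[ℂ] E} (hd : 0 ≤ d) {η : E}
    (h : (⟪η, d η⟫_ℂ).re = 0) : d η = 0 := by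
  have := norm_apply_sq_le hd η
  rw [h, mul_zero] at this
  exact norm_eq_zero.mp (pow_eq_zero_iff two_ne_zero |>.mp (le_antisymm this (sq_nonneg _)))

/-- A bounded increasing net of positive operators converges strongly. -/
theorem exists_strong_limit {α : Type*} [Preorder α] [IsDirectedOrder α] [Nonempty α]
    {y : α → E →L[ℂ] E} (hy : Monotone y) {B : E →L[ℂ] E} (h0 : ∀ i, 0 ≤ y i)
    (hB : ∀ i, y i ≤ B) :
    ∃ z : E →L[ℂ] E, ∀ η, Filter.Tendsto (fun i => y i η) Filter.atTop (𝓝 (z η)) := by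
  have hlim : ∀ η, ∃ v, Filter.Tendsto (fun i => y i η) Filter.atTop (𝓝 v) := by
    intro η
    have hbdd : BddAbove (Set.range fun i => (⟪η, y i η⟫_ℂ).re) :=
      ⟨(⟪η, B η⟫_ℂ).re, by rintro _ ⟨i, rfl⟩; exact inner_re_mono (hB i) η⟩
    set s := ⨆ i, (⟪η, y i η⟫_ℂ).re with hs
    -- `norm_apply_sq_le` for the increment `y j - y i`, whose norm is at most `‖B‖`: convergence of
    -- the scalar net forces the vector net to be Cauchy.
    have hstep : ∀ i j, i ≤ j → ‖y j η - y i η‖ ^ 2 ≤ ‖B‖ * (s - (⟪η, y i η⟫_ℂ).re) := by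
      intro i j hij
      have hd : 0 ≤ y j - y i := sub_nonneg.mpr (hy hij)
      have h1 := norm_apply_sq_le hd η
      have h2 : ‖y j - y i‖ ≤ ‖B‖ := CStarAlgebra.norm_le_norm_of_nonneg_of_le hd
        ((sub_le_self _ (h0 i)).trans (hB j))
      have h3 : (⟪η, (y j - y i) η⟫_ℂ).re ≤ s - (⟪η, y i η⟫_ℂ).re := by
        rw [sub_apply, inner_sub_right, Complex.sub_re]
        exact sub_le_sub_right (le_ciSup hbdd j) _
      rw [sub_apply] at h1
      exact h1.trans (mul_le_mul h2 h3 (inner_re_nonneg hd η) (norm_nonneg _))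
    refine cauchy_iff_exists_le_nhds.mp (Metric.cauchy_iff.mpr ⟨inferInstance, fun ε hε => ?_⟩)
    -- Chosen so that `‖B‖ δ < (ε / 2)²`; the `+ 1` covers `B = 0`.
    have hδ : 0 < (ε / 2) ^ 2 / (‖B‖ + 1) := by positivity
    obtain ⟨i, hi⟩ := exists_lt_of_lt_ciSup (sub_lt_self s hδ)
    have hclose : ∀ j, i ≤ j → dist (y j η) (y i η) < ε / 2 := by
      intro j hij
      rw [dist_eq_norm, ← sq_lt_sq₀ (norm_nonneg _) (by positivity)]
      refine (hstep i j hij).trans_lt ?_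
      have h5 : s - (⟪η, y i η⟫_ℂ).re < (ε / 2) ^ 2 / (‖B‖ + 1) := by linarith
      have h6 : 0 ≤ s - (⟪η, y i η⟫_ℂ).re := sub_nonneg.mpr (le_ciSup hbdd i)
      rw [lt_div_iff₀ (by positivity)] at h5
      nlinarith [norm_nonneg B]
    refine ⟨(fun i => y i η) '' Set.Ici i, Filter.image_mem_map (Filter.Ici_mem_atTop i), ?_⟩
    rintro _ ⟨j, hj, rfl⟩ _ ⟨k, hk, rfl⟩
    have := dist_triangle_right (y j η) (y k η) (y i η)
    linarith [hclose j hj, hclose k hk]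
  choose f hf using hlim
  refine ⟨LinearMap.mkContinuous
    { toFun := f
      map_add' := fun a b => tendsto_nhds_unique (hf (a + b))
        (((hf a).add (hf b)).congr fun i => (map_add _ _ _).symm)
      map_smul' := fun c a => tendsto_nhds_unique (hf (c • a))
        (((hf a).const_smul c).congr fun i => (map_smul _ _ _).symm) } ‖B‖ fun η => ?_, hf⟩
  refine le_of_tendsto (hf η).norm (Filter.Eventually.of_forall fun i => ?_)
  exact (y i).le_of_opNorm_le (CStarAlgebra.norm_le_norm_of_nonneg_of_le (h0 i) (hB i)) η

/-- Commuting with a fixed bounded operator survives strong limits, and `M` is the commutant of its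
commutant. -/
theorem mem_of_strong_limit {α : Type*} {l : Filter α} [l.NeBot] (M : VonNeumannAlgebra E)
    {y : α → E →L[ℂ] E} {z : E →L[ℂ] E} (hy : ∀ i, y i ∈ M)
    (hz : ∀ η, Filter.Tendsto (fun i => y i η) l (𝓝 (z η))) : z ∈ M := by
  rw [← M.commutant_commutant, VonNeumannAlgebra.mem_commutant_iff]
  intro g hg
  rw [VonNeumannAlgebra.mem_commutant_iff] at hg
  ext η
  refine tendsto_nhds_unique ((g.continuous.tendsto _).comp (hz η)) ((hz (g η)).congr fun i => ?_)
  exact DFunLike.congr_fun (hg _ (hy i)) η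

theorem nonneg_of_inner {x : E →L[ℂ] E} (hx : IsSelfAdjoint x)
    (h : ∀ η, 0 ≤ (⟪η, x η⟫_ℂ).re) : 0 ≤ x := by
  rw [ContinuousLinearMap.nonneg_iff_isPositive, ContinuousLinearMap.isPositive_def']
  refine ⟨hx, fun η => ?_⟩
  rw [ContinuousLinearMap.reApplyInnerSelf_apply, inner_re_symm]
  exact h η

theorem isSelfAdjoint_of_strong_limit {α : Type*} {l : Filter α} [l.NeBot]
    {y : α → E →L[ℂ] E} {z : E →L[ℂ] E} (hy : ∀ i, IsSelfAdjoint (y i))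
    (hz : ∀ η, Filter.Tendsto (fun i => y i η) l (𝓝 (z η))) : IsSelfAdjoint z := by
  rw [ContinuousLinearMap.isSelfAdjoint_iff_isSymmetric]
  intro a b
  refine tendsto_nhds_unique ((hz a).inner tendsto_const_nhds)
    ((tendsto_const_nhds.inner (hz b)).congr fun i => ?_)
  exact ((ContinuousLinearMap.isSelfAdjoint_iff_isSymmetric.mp (hy i)) a b).symm

/-- A vector functional, as a map `M⁺ → [0, ∞]`, is normal. -/
theorem isNormal_vector {M : VonNeumannAlgebra E} (η : E) :
    IsNormal (fun x : PosCone M => ENNReal.ofReal (⟪η, x.1 η⟫_ℂ).re) := by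
  intro D hD hdir x hx
  have : Nonempty D := hD.to_subtype
  have : IsDirectedOrder D := ⟨fun a b => by
    obtain ⟨c, hc, hac, hbc⟩ := hdir a a.2 b b.2
    exact ⟨⟨c, hc⟩, hac, hbc⟩⟩
  have hmono : Monotone fun i : D => i.1.1 := fun a b h => h
  obtain ⟨z, hz⟩ := exists_strong_limit hmono (fun i => i.1.2.2) (fun i => hx.1 i.2)
  have hzM : z ∈ M := mem_of_strong_limit M (fun i : D => i.1.2.1) hz
  have hzsa : IsSelfAdjoint z :=
    isSelfAdjoint_of_strong_limit (fun i : D => .of_nonneg i.1.2.2) hz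
  have hle : ∀ i : D, i.1.1 ≤ z := fun i => by
    refine sub_nonneg.mp (nonneg_of_inner (hzsa.sub (.of_nonneg i.1.2.2)) fun ζ => ?_)
    rw [sub_apply, inner_sub_right, Complex.sub_re, sub_nonneg]
    refine ge_of_tendsto (tendsto_inner_re hz ζ) ?_
    filter_upwards [Filter.Ici_mem_atTop i] with j hj using inner_re_mono (hmono hj) ζ
  have hz0 : 0 ≤ z := (Classical.arbitrary D).1.2.2.trans (hle _)
  -- `x` is a least upper bound only within `M⁺`. The strong limit `z` competes with it because it
  -- has been shown to lie in `M`.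
  have hxz : x.1 ≤ z := hx.2 (show (⟨z, hzM, hz0⟩ : PosCone M) ∈ upperBounds D from
    fun y hy => hle ⟨y, hy⟩)
  refine le_antisymm ?_ (iSup₂_le fun y hy => ENNReal.ofReal_le_ofReal (inner_re_mono (hx.1 hy) η))
  refine (ENNReal.ofReal_le_ofReal (inner_re_mono hxz η)).trans ?_
  refine le_of_tendsto ((ENNReal.continuous_ofReal.tendsto _).comp (tendsto_inner_re hz η))
    (Filter.Eventually.of_forall fun i => ?_)
  exact le_iSup₂ (f := fun (y : PosCone M) (_ : y ∈ D) => ENNReal.ofReal (⟪η, y.1 η⟫_ℂ).re) i.1 i.2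

theorem IsNormal.const_mul {M : VonNeumannAlgebra E} {φ : PosCone M → ℝ≥0∞} (h : IsNormal φ)
    (c : ℝ≥0∞) : IsNormal fun x => c * φ x := fun D hD hdir x hx => by
  simp only [h D hD hdir x hx, ENNReal.mul_iSup]

theorem IsNormal.iSup {ι : Type*} {M : VonNeumannAlgebra E} {φ : ι → PosCone M → ℝ≥0∞}
    (h : ∀ i, IsNormal (φ i)) : IsNormal fun x => ⨆ i, φ i x := fun D hD hdir x hx => by
  simp only [fun i => h i D hD hdir x hx]
  rw [iSup_comm]
  refine iSup_congr fun y => ?_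
  rw [iSup_comm]

/-- Compressions by a sequence of contractions converging strongly to `1` converge `σ`-weakly. -/
theorem tendsto_sigmaWeak_compress {s : ℕ → E →L[ℂ] E} (hsa : ∀ n, IsSelfAdjoint (s n))
    (hn : ∀ n, ‖s n‖ ≤ 1) (hs : ∀ η, Filter.Tendsto (fun n => s n η) Filter.atTop (𝓝 η))
    (x : E →L[ℂ] E) :
    Filter.Tendsto (fun n => s n * x * s n) Filter.atTop (@nhds _ (sigmaWeak E) x) := by
  simp only [nhds_iInf, Filter.tendsto_iInf, nhds_induced, Filter.tendsto_comap_iff]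
  intro η ζ hη hζ
  refine tendsto_tsum_of_dominated_convergence (bound := fun i => ‖x‖ * (‖η i‖ * ‖ζ i‖))
    ((summable_norm_mul_norm hη hζ).mul_left _) (fun i => ?_)
    (Filter.Eventually.of_forall fun n i => ?_)
  -- Moving the left `s n` across the inner product leaves strong convergence in both arguments.
  · have h : ∀ n, ⟪s n (η i), x (s n (ζ i))⟫_ℂ = ⟪η i, (s n * x * s n) (ζ i)⟫_ℂ := fun n => by
      rw [← ContinuousLinearMap.adjoint_inner_right, ← ContinuousLinearMap.star_eq_adjoint,
        (hsa n).star_eq]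
      rfl
    exact ((hs (η i)).inner ((x.continuous.tendsto _).comp (hs (ζ i)))).congr h
  · have h1 : ‖s n * x * s n‖ ≤ ‖x‖ := by
      calc ‖s n * x * s n‖ ≤ ‖s n‖ * ‖x‖ * ‖s n‖ :=
            (norm_mul_le _ _).trans (mul_le_mul_of_nonneg_right (norm_mul_le _ _) (norm_nonneg _))
        _ ≤ 1 * ‖x‖ * 1 := by gcongr <;> exact hn n
        _ = ‖x‖ := by ring
    calc ‖⟪η i, (s n * x * s n) (ζ i)⟫_ℂ‖ ≤ ‖η i‖ * (‖x‖ * ‖ζ i‖) :=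
          (norm_inner_le_norm _ _).trans
            (mul_le_mul_of_nonneg_left ((s n * x * s n).le_of_opNorm_le h1 _) (norm_nonneg _))
      _ = _ := by ring

/-- If self-adjoint contractions `s n` converge strongly to `1` and `φ(s n * x * s n) < ∞` for all
`x ∈ M⁺`, then `φ` is semi-finite. -/
theorem isSemifinite_of_compress {M : VonNeumannAlgebra E} {φ : PosCone M → ℝ≥0∞}
    {s : ℕ → E →L[ℂ] E} (hsa : ∀ n, IsSelfAdjoint (s n)) (hn : ∀ n, ‖s n‖ ≤ 1)
    (hs : ∀ η, Filter.Tendsto (fun n => s n η) Filter.atTop (𝓝 η))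
    (hφ : ∀ n, ∀ x : PosCone M, ∃ y : PosCone M, y.1 = s n * x.1 * s n ∧ φ y < ∞) :
    IsSemifinite φ := by
  intro x hx
  have hM : ∀ (c : ℂ) (a : E →L[ℂ] E), a ∈ M → c • a ∈ M := fun c a ha =>
    M.toStarSubalgebra.smul_mem ha c
  have hpos : ∀ n, ∀ a : E →L[ℂ] E, a ∈ M → 0 ≤ a → s n * a * s n ∈ integrableSpan φ := by
    intro n a ha ha0
    obtain ⟨y, hy, hy'⟩ := hφ n ⟨a, ha, ha0⟩
    exact Submodule.subset_span ⟨y, hy', hy⟩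
  have hself : ∀ n, ∀ a : E →L[ℂ] E, a ∈ M → IsSelfAdjoint a →
      s n * a * s n ∈ integrableSpan φ := by
    intro n a ha hasa
    have e : algebraMap ℝ (E →L[ℂ] E) ‖a‖ = (‖a‖ : ℂ) • 1 := by
      rw [Algebra.algebraMap_eq_smul_one, Complex.coe_smul]
    have h1 : algebraMap ℝ (E →L[ℂ] E) ‖a‖ ∈ M := by
      rw [e]
      exact hM _ _ (one_mem M)
    have h2 : (0 : E →L[ℂ] E) ≤ algebraMap ℝ (E →L[ℂ] E) ‖a‖ :=
      algebraMap_nonneg _ (norm_nonneg a)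
    -- A self-adjoint `a` is the difference of the positive elements `‖a‖` and `‖a‖ - a` of `M`; a
    -- general `x` is then split into real and imaginary parts.
    have h3 := hpos n _ (sub_mem h1 ha) (sub_nonneg.mpr hasa.le_algebraMap_norm_self)
    have h4 := Submodule.sub_mem _ (hpos n _ h1 h2) h3
    convert h4 using 1
    noncomm_ring
  refine @mem_closure_of_tendsto _ (sigmaWeak E) _ _ _ _ _ _
    (tendsto_sigmaWeak_compress hsa hn hs x) (Filter.Eventually.of_forall fun n => ?_)
  have h5 := hself n (realPart x : E →L[ℂ] E) ?_ (realPart x).2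
  have h6 := hself n (imaginaryPart x : E →L[ℂ] E) ?_ (imaginaryPart x).2
  · have h7 := Submodule.add_mem _ h5 (Submodule.smul_mem _ Complex.I h6)
    have h8 : s n * x * s n = s n * (realPart x : E →L[ℂ] E) * s n
        + Complex.I • (s n * (imaginaryPart x : E →L[ℂ] E) * s n) := by
      conv_lhs => rw [← realPart_add_I_smul_imaginaryPart x]
      rw [mul_add, add_mul, mul_smul_comm, smul_mul_assoc]
    rw [SetLike.mem_coe, h8]
    exact h7
  · rw [imaginaryPart_apply_coe, ← Complex.coe_smul]
    exact hM _ _ (hM _ _ (sub_mem hx (star_mem hx)))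
  · rw [realPart_apply_coe, ← Complex.coe_smul]
    exact hM _ _ (add_mem hx (star_mem hx))

end OpAlg

/-! ### Operators in single legs of the infinite tensor product. -/

namespace InfTensor

theorem norm_completion_le {A B : Type*} [SeminormedAddCommGroup A] [NormedSpace ℂ A]
    [SeminormedAddCommGroup B] [NormedSpace ℂ B] (f : A →L[ℂ] B) : ‖f.completion‖ ≤ ‖f‖ := by
  refine ContinuousLinearMap.opNorm_le_bound _ (norm_nonneg _) fun v => ?_
  induction v using UniformSpace.Completion.induction_on with
  | hp => exact isClosed_le (by fun_prop) (by fun_prop)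
  | ih f' =>
    rw [ContinuousLinearMap.completion_apply_coe, UniformSpace.Completion.norm_coe,
      UniformSpace.Completion.norm_coe]
    exact f.le_opNorm f'

variable {ι : Type*} {H : ι → Type*} {ξ : ∀ i, H i}

theorem Elem.ext {x y : Elem ξ} (h : ∀ i, x.1 i = y.1 i) : x = y := Subtype.ext (funext h)

theorem Elem.update_same [DecidableEq ι] (x : Elem ξ) (i : ι) (v : H i) : (x.update i v).1 i = v :=
  Function.update_self _ _ _

theorem Elem.update_ne [DecidableEq ι] (x : Elem ξ) (i : ι) (v : H i) {j : ι} (h : j ≠ i) :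
    (x.update i v).1 j = x.1 j :=
  Function.update_of_ne h _ _

variable [∀ i, NormedAddCommGroup (H i)] [∀ i, InnerProductSpace ℂ (H i)] (hξ : ∀ i, ‖ξ i‖ = 1)

theorem dense_span_tprod :
    Dense (Submodule.span ℂ (Set.range (tprod hξ)) : Set (Tensor ξ hξ)) := by
  refine UniformSpace.Completion.denseRange_coe.mono ?_
  rintro _ ⟨f, rfl⟩
  obtain ⟨g, rfl⟩ := (toPre ξ hξ).surjective f
  induction g using Finsupp.induction_linear with
  | zero =>
    rw [map_zero, UniformSpace.Completion.coe_zero]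
    exact Submodule.zero_mem _
  | add f g hf hg =>
    rw [map_add, UniformSpace.Completion.coe_add]
    exact Submodule.add_mem _ hf hg
  | single x c =>
    have : toPre ξ hξ (Finsupp.single x c) = c • toPre ξ hξ (Finsupp.single x 1) := by
      rw [← map_smul, Finsupp.smul_single, smul_eq_mul, mul_one]
    rw [this, UniformSpace.Completion.coe_smul]
    exact Submodule.smul_mem _ _ (Submodule.subset_span ⟨x, rfl⟩)

theorem ext_tprod {F : Type*} [NormedAddCommGroup F] [NormedSpace ℂ F]
    {S T : Tensor ξ hξ →L[ℂ] F} (h : ∀ x, S (tprod hξ x) = T (tprod hξ x)) : S = T :=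
  ContinuousLinearMap.ext_on (dense_span_tprod hξ) (by rintro _ ⟨x, rfl⟩; exact h x)

variable [DecidableEq ι]

theorem leg_one (i : ι) : leg hξ i (1 : H i →L[ℂ] H i) = 1 := by
  refine ext_tprod hξ fun x => ?_
  rw [leg_tprod, one_apply_eq_self]
  congr 1
  refine Elem.ext fun j => ?_
  by_cases h : j = i
  · subst h; rw [Elem.act_same, one_apply_eq_self]
  · rw [Elem.act_ne _ _ _ h]

theorem leg_mul (i : ι) (S T : H i →L[ℂ] H i) : leg hξ i (S * T) = leg hξ i S * leg hξ i T := by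
  refine ext_tprod hξ fun x => ?_
  rw [mul_apply_eq_comp, leg_tprod, leg_tprod, leg_tprod]
  congr 1
  refine Elem.ext fun j => ?_
  by_cases h : j = i
  · subst h; rw [Elem.act_same, Elem.act_same, Elem.act_same, mul_apply_eq_comp]
  · rw [Elem.act_ne _ _ _ h, Elem.act_ne _ _ _ h, Elem.act_ne _ _ _ h]

theorem leg_commute_of_commute (i : ι) {S T : H i →L[ℂ] H i} (h : Commute S T) :
    Commute (leg hξ i S) (leg hξ i T) := by
  rw [commute_iff_eq, ← leg_mul, ← leg_mul, h.eq]

theorem leg_commute_of_ne {i j : ι} (h : i ≠ j) (S : H i →L[ℂ] H i) (T : H j →L[ℂ] H j) :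
    Commute (leg hξ i S) (leg hξ j T) := by
  refine ext_tprod hξ fun x => ?_
  rw [mul_apply_eq_comp, mul_apply_eq_comp, leg_tprod, leg_tprod, leg_tprod, leg_tprod]
  congr 1
  refine Elem.ext fun k => ?_
  by_cases hi : k = i
  · subst hi
    rw [Elem.act_same, Elem.act_ne _ _ _ h, Elem.act_ne _ _ _ h, Elem.act_same]
  · by_cases hj : k = j
    · subst hj
      rw [Elem.act_ne _ _ _ hi, Elem.act_same, Elem.act_same, Elem.act_ne _ _ _ hi]
    · rw [Elem.act_ne _ _ _ hi, Elem.act_ne _ _ _ hj, Elem.act_ne _ _ _ hj, Elem.act_ne _ _ _ hi]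

theorem norm_leg_le (i : ι) (T : H i →L[ℂ] H i) : ‖leg hξ i T‖ ≤ ‖T‖ :=
  (norm_completion_le _).trans (LinearMap.mkContinuous_norm_le _ (norm_nonneg T) _)

theorem leg_star [∀ i, CompleteSpace (H i)] (i : ι) (T : H i →L[ℂ] H i) :
    leg hξ i (star T) = star (leg hξ i T) := by
  refine ext_tprod hξ fun x => ?_
  refine (dense_span_tprod hξ).eq_of_inner_right (𝕜 := ℂ) fun v hv => ?_
  -- The vectors pairing equally with both sides form a subspace, the kernel of a functional, so
  -- elementary tensors suffice; for them the adjoint moves inside factor `i`.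
  have hle : Submodule.span ℂ (Set.range (tprod hξ)) ≤
      LinearMap.ker ((innerSL ℂ (leg hξ i (star T) (tprod hξ x)
        - (star (leg hξ i T)) (tprod hξ x))).toLinearMap) := by
    rw [Submodule.span_le]
    rintro _ ⟨y, rfl⟩
    rw [SetLike.mem_coe, LinearMap.mem_ker]
    change ⟪_ - _, tprod hξ y⟫_ℂ = 0
    rw [inner_sub_left, sub_eq_zero, ContinuousLinearMap.star_eq_adjoint (leg hξ i T),
      ContinuousLinearMap.adjoint_inner_left, leg_tprod, leg_tprod, inner_tprod, inner_tprod]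
    refine finprod_congr fun j => ?_
    by_cases h : j = i
    · subst h
      rw [Elem.act_same, Elem.act_same, ContinuousLinearMap.star_eq_adjoint,
        ContinuousLinearMap.adjoint_inner_left]
    · rw [Elem.act_ne _ _ _ h, Elem.act_ne _ _ _ h]
  have := hle hv
  rw [LinearMap.mem_ker] at this
  change ⟪_ - _, v⟫_ℂ = 0 at this
  rw [inner_sub_left, sub_eq_zero] at this
  rw [← inner_conj_symm, this, inner_conj_symm]

/-- The constant is the product of the `‖x_j‖²` over `j ≠ i`, all but finitely many of which are
`1`. Thus inserting a vector in slot `i` is isometric up to a scalar. -/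
theorem inner_tprod_update (x : Elem ξ) (i : ι) : ∃ c : ℂ, ∀ u v : H i,
    ⟪tprod hξ (x.update i u), tprod hξ (x.update i v)⟫_ℂ = c * ⟪u, v⟫_ℂ := by
  refine ⟨∏ᶠ j, if j = i then 1 else ⟪x.1 j, x.1 j⟫_ℂ, fun u v => ?_⟩
  set F := insert i (finite_mulSupport hξ x x).toFinset with hF
  have hi : i ∈ F := Finset.mem_insert_self _ _
  have hout : ∀ j, j ∉ F → ⟪x.1 j, x.1 j⟫_ℂ = 1 := fun j hj => by
    by_contra h
    exact hj (Finset.mem_insert_of_mem (by simpa using h))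
  rw [inner_tprod, finprod_eq_prod_of_mulSupport_subset (s := F),
    finprod_eq_prod_of_mulSupport_subset (s := F), ← Finset.mul_prod_erase F _ hi,
    ← Finset.mul_prod_erase F _ hi, if_pos rfl, one_mul, Elem.update_same, Elem.update_same,
    mul_comm]
  · congr 1
    refine Finset.prod_congr rfl fun j hj => ?_
    have h := Finset.ne_of_mem_erase hj
    rw [if_neg h, Elem.update_ne _ _ _ h, Elem.update_ne _ _ _ h]
  all_goals
    intro j hj
    by_contra h
    have h1 : j ≠ i := fun e => h (e ▸ hi)
    refine hj ?_
    simp only [h1, if_false, Elem.update_ne _ _ _ h1]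
    exact hout j h

/-- Expanding the square with `inner_tprod_update` gives `‖⊗u - ⊗v‖² = c ‖u - v‖²`, without using
that the tensor is linear in the slot. -/
theorem continuous_tprod_update (x : Elem ξ) (i : ι) :
    Continuous fun u : H i => tprod hξ (x.update i u) := by
  obtain ⟨c, hc⟩ := inner_tprod_update hξ x i
  have key : ∀ u v : H i, ((‖tprod hξ (x.update i u) - tprod hξ (x.update i v)‖ ^ 2 : ℝ) : ℂ)
      = c * ((‖u - v‖ ^ 2 : ℝ) : ℂ) := fun u v => by
    have h1 : ((‖u - v‖ ^ 2 : ℝ) : ℂ) = ⟪u - v, u - v⟫_ℂ := by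
      rw [inner_self_eq_norm_sq_to_K]; simp
    have h2 : ((‖tprod hξ (x.update i u) - tprod hξ (x.update i v)‖ ^ 2 : ℝ) : ℂ)
        = ⟪tprod hξ (x.update i u) - tprod hξ (x.update i v),
          tprod hξ (x.update i u) - tprod hξ (x.update i v)⟫_ℂ := by
      rw [inner_self_eq_norm_sq_to_K]; simp
    rw [h1, h2]
    simp only [inner_sub_left, inner_sub_right, hc]
    ring
  refine continuous_iff_continuousAt.mpr fun v => tendsto_iff_norm_sub_tendsto_zero.mpr ?_
  have hn : ∀ u : H i, ‖tprod hξ (x.update i u) - tprod hξ (x.update i v)‖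
      = √(‖c‖ * ‖u - v‖ ^ 2) := fun u => by
    have := congrArg norm (key u v)
    rw [norm_mul, Complex.norm_real, Complex.norm_real, Real.norm_of_nonneg (by positivity),
      Real.norm_of_nonneg (by positivity)] at this
    rw [← this, Real.sqrt_sq (norm_nonneg _)]
  simp only [hn]
  have hcont : Continuous fun u : H i => √(‖c‖ * ‖u - v‖ ^ 2) := by fun_prop
  simpa using hcont.tendsto v

/-- A bounded operator that annihilates `⊗_i ξ_i` and commutes with enough operators in each leg to
make `ξ_i` cyclic for them vanishes. -/
theorem eq_zero_of_commute_leg {x : Tensor ξ hξ →L[ℂ] Tensor ξ hξ}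
    (D : ∀ i, Set (H i →L[ℂ] H i)) (hD : ∀ i, Dense ((fun T : H i →L[ℂ] H i => T (ξ i)) '' D i))
    (hx : ∀ i, ∀ T ∈ D i, Commute x (leg hξ i T)) (e : Elem ξ) (he : ∀ i, e.1 i = ξ i)
    (h0 : x (tprod hξ e) = 0) : x = 0 := by
  -- Induction on the set of slots where `v` may differ from `ξ`. In a new slot, the tensor with
  -- entry `T ξ_i` is the leg operator of `T` applied to the tensor with entry `ξ_i`. That operator
  -- commutes past `x`, and the vectors `T ξ_i` are dense.
  have key : ∀ F : Finset ι, ∀ v : Elem ξ, (∀ i, i ∉ F → v.1 i = ξ i) → x (tprod hξ v) = 0 := by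
    intro F
    induction F using Finset.induction_on with
    | empty =>
      intro v hv
      rw [Elem.ext (y := e) fun i => (hv i (Finset.notMem_empty i)).trans (he i).symm, h0]
    | insert i F _ ih =>
      intro v hv
      have hcl : IsClosed {u : H i | x (tprod hξ (v.update i u)) = 0} :=
        isClosed_singleton.preimage (x.continuous.comp (continuous_tprod_update hξ v i))
      have hsub : (fun T : H i →L[ℂ] H i => T (ξ i)) '' D i
          ⊆ {u : H i | x (tprod hξ (v.update i u)) = 0} := by
        rintro _ ⟨T, hT, rfl⟩
        have h1 : v.update i (T (ξ i)) = (v.update i (ξ i)).act i T := Elem.ext fun j => by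
          by_cases h : j = i
          · subst h; rw [Elem.update_same, Elem.act_same, Elem.update_same]
          · rw [Elem.update_ne _ _ _ h, Elem.act_ne _ _ _ h, Elem.update_ne _ _ _ h]
        have h2 : x (tprod hξ (v.update i (ξ i))) = 0 := ih _ fun j hj => by
          by_cases h : j = i
          · subst h; rw [Elem.update_same]
          · rw [Elem.update_ne _ _ _ h]
            exact hv j (by simp [h, hj])
        change x (tprod hξ (v.update i (T (ξ i)))) = 0
        rw [h1, ← leg_tprod, ← mul_apply_eq_comp, (hx i T hT).eq, mul_apply_eq_comp, h2, map_zero]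
      have h3 := hcl.closure_subset_iff.mpr hsub ((hD i).closure_eq ▸ Set.mem_univ (v.1 i))
      have h4 : v.update i (v.1 i) = v := Elem.ext fun j => by
        by_cases h : j = i
        · subst h; rw [Elem.update_same]
        · rw [Elem.update_ne _ _ _ h]
      rwa [Set.mem_ofPred_eq, h4] at h3
  refine ext_tprod hξ fun v => ?_
  rw [key v.2.toFinset v fun i hi => by simpa using hi, zero_apply]

end InfTensor

/-! ### Bounded right multiplications on the GNS space of one factor. -/

namespace QSU2

/-- The shift by `l` in the second variable of `ℓ²(ℕ × ℤ)`. -/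
noncomputable def shift (l : ℤ) : Hilb →L[ℂ] Hilb :=
  weightedComp (fun _ => 1) (fun i => (i.1, i.2 - l)) (fun _ => by simp) (fun i _ j _ h => by
    simp only [Prod.mk.injEq, sub_left_inj] at h
    exact Prod.ext h.1 h.2)

theorem shift_apply (l : ℤ) (x : Hilb) (n : ℕ) (k : ℤ) : shift l x (n, k) = x (n, k - l) :=
  one_mul _

theorem norm_shift_le (l : ℤ) (x : Hilb) : ‖shift l x‖ ≤ ‖x‖ := by
  have h : ‖shift l‖ ≤ 1 := by
    unfold shift weightedComp
    exact LinearMap.mkContinuous_norm_le _ zero_le_one _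
  simpa using (shift l).le_of_opNorm_le h x

theorem norm_shift (l : ℤ) (x : Hilb) : ‖shift l x‖ = ‖x‖ := by
  refine le_antisymm (norm_shift_le l x) ?_
  have h : shift (-l) (shift l x) = x := by
    ext ⟨n, k⟩
    rw [shift_apply, shift_apply]
    simp
  conv_lhs => rw [← h]
  exact norm_shift_le _ _

theorem shift_basisVec (n : ℕ) (k l : ℤ) : shift l (basisVec n k) = basisVec n (k + l) := by
  ext ⟨r, m⟩
  simp only [shift_apply, basisVec_apply, sub_eq_iff_eq_add]

theorem commute_shift (q : Param) (l : ℤ) {y : Hilb →L[ℂ] Hilb} (hy : y ∈ cAlg q) :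
    Commute y (shift l) := by
  -- Both `y` and `star y` are carried along: the adjoint of the relation for `y` would concern the
  -- adjoint of the shift instead.
  have hadj : ∀ y ∈ StarAlgebra.adjoin ℂ {opA q, opB q},
      Commute y (shift l) ∧ Commute (star y) (shift l) := by
    intro y hy
    induction hy using StarAlgebra.adjoin_induction with
    | mem x hx =>
      rcases hx with rfl | rfl
      · refine ⟨?_, ?_⟩ <;> ext x ⟨n, k⟩
        · change opA q (shift l x) (n, k) = shift l (opA q x) (n, k)
          rw [opA_apply, shift_apply, shift_apply, opA_apply]
        · change (star (opA q) : Hilb →L[ℂ] Hilb) (shift l x) (n, k)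
            = shift l ((star (opA q) : Hilb →L[ℂ] Hilb) x) (n, k)
          cases n with
          | zero => rw [opA_star_apply_zero, shift_apply, opA_star_apply_zero]
          | succ n => rw [opA_star_apply_succ, shift_apply, shift_apply, opA_star_apply_succ]
      · refine ⟨?_, ?_⟩ <;> ext x ⟨n, k⟩
        · change opB q (shift l x) (n, k) = shift l (opB q x) (n, k)
          rw [opB_apply, shift_apply, shift_apply, opB_apply, sub_right_comm]
        · change (star (opB q) : Hilb →L[ℂ] Hilb) (shift l x) (n, k)
            = shift l ((star (opB q) : Hilb →L[ℂ] Hilb) x) (n, k)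
          rw [opB_star_apply, shift_apply, shift_apply, opB_star_apply, sub_add_eq_add_sub]
    | algebraMap r =>
      rw [← algebraMap_star_comm]
      exact ⟨Algebra.commutes _ _, Algebra.commutes _ _⟩
    | add x y _ _ hx hy =>
      rw [star_add]
      exact ⟨hx.1.add_left hy.1, hx.2.add_left hy.2⟩
    | mul x y _ _ hx hy =>
      rw [star_mul]
      exact ⟨hx.1.mul_left hy.1, hy.2.mul_left hx.2⟩
    | star x _ hx => exact ⟨hx.2, (star_star x).symm ▸ hx.1⟩
  have hcl : IsClosed {y : Hilb →L[ℂ] Hilb | y * shift l = shift l * y} :=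
    isClosed_eq (by fun_prop) (by fun_prop)
  exact hcl.closure_subset_iff.mpr (fun y hy => (hadj y hy).1.eq) hy

/-- The Haar state only sees `ξ_{n,0}`, whereas `b` moves this vector to `ξ_{n,1}`. Translation
invariance in the second index removes the discrepancy. -/
theorem norm_rep_basisVec (q : Param) (y : CSU q) (n : ℕ) (k : ℤ) :
    ‖rep q y (basisVec n k)‖ = ‖rep q y (basisVec n 0)‖ := by
  have h := DFunLike.congr_fun (commute_shift q k (y := rep q y) y.2).eq (basisVec n 0)
  rw [mul_apply_eq_comp, mul_apply_eq_comp, shift_basisVec, zero_add] at h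
  rw [h, norm_shift]

theorem Param.sq_pos (q : Param) : 0 < (q : ℝ) ^ 2 := by
  rw [← sq_abs]; exact pow_pos q.2.1 2

theorem Param.sq_lt_one (q : Param) : (q : ℝ) ^ 2 < 1 := by
  rw [← sq_abs]; exact pow_lt_one₀ (abs_nonneg _) q.2.2 two_ne_zero

theorem summable_weighted_norm (q : Param) (y : CSU q) :
    Summable fun n : ℕ => (q : ℝ) ^ (2 * n) * ‖rep q y (basisVec n 0)‖ ^ 2 := by
  refine Summable.of_nonneg_of_le (fun n => by rw [pow_mul]; positivity) (fun n => ?_)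
    ((summable_geometric_of_lt_one q.sq_pos.le q.sq_lt_one).mul_right (‖rep q y‖ ^ 2))
  rw [pow_mul]
  gcongr
  have := (rep q y).le_opNorm (basisVec n 0)
  rwa [basisVec_norm, mul_one] at this

theorem haar_star_mul_self (q : Param) (y : CSU q) :
    haar q (star y * y) = (((1 - (q : ℝ) ^ 2) *
      ∑' n : ℕ, (q : ℝ) ^ (2 * n) * ‖rep q y (basisVec n 0)‖ ^ 2 : ℝ) : ℂ) := by
  rw [haar_apply, Complex.ofReal_mul, Complex.ofReal_tsum]
  push_cast
  congr 2 with n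
  rw [map_mul, map_star, mul_apply_eq_comp, ContinuousLinearMap.star_eq_adjoint,
    ContinuousLinearMap.adjoint_inner_right, inner_self_eq_norm_sq_to_K]
  simp

/-- If `a` acts on the basis as a weighted partial permutation that changes the weights `q^{2n}` by
at most a factor `C`, right multiplication by `a` is bounded for the GNS norm. -/
theorem haar_mul_right_le (q : Param) (a : CSU q) (c : ℕ → ℂ) (σ : ℕ → ℕ) (k : ℕ → ℤ) (C : ℝ)
    (ha : ∀ n, rep q a (basisVec n 0) = c n • basisVec (σ n) (k n)) (hc : ∀ n, ‖c n‖ ≤ 1)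
    (hσ : Set.InjOn σ (Function.support c))
    (hC : ∀ n, c n ≠ 0 → (q : ℝ) ^ (2 * n) ≤ C * (q : ℝ) ^ (2 * σ n)) (hC0 : 0 ≤ C) (y : CSU q) :
    (haar q (star (y * a) * (y * a))).re ≤ C * (haar q (star y * y)).re := by
  classical
  rw [haar_star_mul_self, haar_star_mul_self, Complex.ofReal_re, Complex.ofReal_re,
    mul_left_comm]
  refine mul_le_mul_of_nonneg_left ?_ (sub_nonneg.mpr q.sq_lt_one.le)
  set g : ℕ → ℝ := fun n => (q : ℝ) ^ (2 * n) * ‖rep q y (basisVec n 0)‖ ^ 2 with hg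
  have hg0 : ∀ n, 0 ≤ g n := fun n => by simp only [hg]; rw [pow_mul]; positivity
  have hterm : ∀ n, ‖rep q (y * a) (basisVec n 0)‖ = ‖c n‖ * ‖rep q y (basisVec (σ n) 0)‖ :=
    fun n => by rw [map_mul, mul_apply_eq_comp, ha, map_smul, norm_smul, norm_rep_basisVec]
  refine (summable_weighted_norm q (y * a)).tsum_le_of_sum_le fun s => ?_
  -- Terms with `c n = 0` are dropped first, since `σ` is injective only on the support of `c`. The
  -- remaining terms are reindexed by `σ`, each level being hit at most once.
  calc ∑ n ∈ s, (q : ℝ) ^ (2 * n) * ‖rep q (y * a) (basisVec n 0)‖ ^ 2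
      = ∑ n ∈ s with c n ≠ 0, (q : ℝ) ^ (2 * n) * ‖rep q (y * a) (basisVec n 0)‖ ^ 2 := by
        refine (Finset.sum_filter_of_ne (p := fun i => c i ≠ 0) fun i _ h h0 => h ?_).symm
        rw [hterm, h0]; simp
    _ ≤ ∑ n ∈ s with c n ≠ 0, C * g (σ n) := by
        refine Finset.sum_le_sum fun n hn => ?_
        have hn' := (Finset.mem_filter.mp hn).2
        simp only [hg]
        rw [hterm, mul_pow, ← mul_assoc, ← mul_assoc]
        refine mul_le_mul_of_nonneg_right ?_ (sq_nonneg _)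
        refine le_trans ?_ (hC n hn')
        refine mul_le_of_le_one_right (by rw [pow_mul]; positivity) ?_
        exact pow_le_one₀ (norm_nonneg _) (hc n)
    _ = C * ∑ m ∈ (s.filter fun i => c i ≠ 0).image σ, g m := by
        rw [Finset.sum_image, Finset.mul_sum]
        intro i hi j hj h
        simp only [Finset.coe_filter, Set.mem_ofPred_eq] at hi hj
        exact hσ hi.2 hj.2 h
    _ ≤ C * ∑' n, g n := by
        gcongr
        exact (summable_weighted_norm q y).sum_le_tsum _ fun n _ => hg0 n

theorem gnsRep_gnsVec (q : Param) (z : CSU q) :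
    gnsRep q z (gnsVec q) = (((haar q).toPreGNS z : (haar q).PreGNS) : L2 q) := by
  change (haar q).gnsNonUnitalStarAlgHom z (gnsVec q) = _
  rw [gnsVec, PositiveLinearMap.gnsNonUnitalStarAlgHom_apply_coe,
    PositiveLinearMap.leftMulMapPreGNS_apply]
  simp

theorem denseRange_gnsRep (q : Param) : DenseRange fun y : CSU q => gnsRep q y (gnsVec q) := by
  refine UniformSpace.Completion.denseRange_coe.mono ?_
  rintro _ ⟨z, rfl⟩
  exact ⟨(haar q).ofPreGNS z, gnsRep_gnsVec q _⟩

/-- Right multiplication by `a` as a bounded operator on the GNS space. -/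
theorem exists_rightMul (q : Param) (a : CSU q) (C : ℝ)
    (h : ∀ y, (haar q (star (y * a) * (y * a))).re ≤ C * (haar q (star y * y)).re) :
    ∃ T : L2 q →L[ℂ] L2 q, (∀ y, T (gnsRep q y (gnsVec q)) = gnsRep q (y * a) (gnsVec q)) ∧
      ‖T‖ ≤ √C := by
  let T₀ : (haar q).PreGNS →L[ℂ] (haar q).PreGNS :=
    LinearMap.mkContinuous ((haar q).toPreGNS.toLinearMap ∘ₗ LinearMap.mulRight ℂ a ∘ₗ
      (haar q).ofPreGNS.toLinearMap) √C fun y => by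
      have h0 : 0 ≤ (haar q (star ((haar q).ofPreGNS y) * (haar q).ofPreGNS y)).re :=
        (RCLike.nonneg_iff.mp ((haar q).map_nonneg (star_mul_self_nonneg _))).1
      rw [PositiveLinearMap.preGNS_norm_def, PositiveLinearMap.preGNS_norm_def,
        ← Real.sqrt_mul' _ h0]
      exact Real.sqrt_le_sqrt (h _)
  refine ⟨T₀.completion, fun y => ?_, (InfTensor.norm_completion_le T₀).trans
    (LinearMap.mkContinuous_norm_le _ (Real.sqrt_nonneg _) _)⟩
  rw [gnsRep_gnsVec, gnsRep_gnsVec, ContinuousLinearMap.completion_apply_coe]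
  rfl

/-- Right multiplications commute with the GNS representation. -/
theorem commute_of_rightMul (q : Param) {a : CSU q} {T : L2 q →L[ℂ] L2 q}
    (hT : ∀ y, T (gnsRep q y (gnsVec q)) = gnsRep q (y * a) (gnsVec q)) (x : CSU q) :
    Commute T (gnsRep q x) := by
  refine DFunLike.coe_injective ((denseRange_gnsRep q).equalizer (ContinuousLinearMap.continuous _)
    (ContinuousLinearMap.continuous _) (funext fun y => ?_))
  change T (gnsRep q x (gnsRep q y (gnsVec q))) = gnsRep q x (T (gnsRep q y (gnsVec q)))
  rw [hT, ← mul_apply_eq_comp (gnsRep q x), ← map_mul, ← mul_apply_eq_comp (gnsRep q x),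
    ← map_mul, hT, mul_assoc]

/-- The subalgebra of the elements `a` for which right multiplication by `a` is bounded on the GNS
space. -/
def rightBounded (q : Param) : Subalgebra ℂ (CSU q) where
  carrier := {a | ∃ T : L2 q →L[ℂ] L2 q,
    ∀ y, T (gnsRep q y (gnsVec q)) = gnsRep q (y * a) (gnsVec q)}
  mul_mem' := by
    rintro a b ⟨S, hS⟩ ⟨T, hT⟩
    exact ⟨T * S, fun y => by rw [mul_apply_eq_comp, hS, hT, mul_assoc]⟩
  add_mem' := by
    rintro a b ⟨S, hS⟩ ⟨T, hT⟩
    exact ⟨S + T, fun y => by rw [add_apply, hS, hT, mul_add, map_add, add_apply]⟩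
  algebraMap_mem' r := ⟨r • 1, fun y => by
    rw [smul_apply, one_apply_eq_self, Algebra.algebraMap_eq_smul_one, mul_smul_comm, mul_one,
      map_smul, smul_apply]⟩

theorem mem_rightBounded_of_basis (q : Param) (a : CSU q) (c : ℕ → ℂ) (σ : ℕ → ℕ) (k : ℕ → ℤ)
    (C : ℝ) (ha : ∀ n, rep q a (basisVec n 0) = c n • basisVec (σ n) (k n)) (hc : ∀ n, ‖c n‖ ≤ 1)
    (hσ : Set.InjOn σ (Function.support c))
    (hC : ∀ n, c n ≠ 0 → (q : ℝ) ^ (2 * n) ≤ C * (q : ℝ) ^ (2 * σ n)) (hC0 : 0 ≤ C) :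
    a ∈ rightBounded q := by
  obtain ⟨T, hT, -⟩ := exists_rightMul q a C (haar_mul_right_le q a c σ k C ha hc hσ hC hC0)
  exact ⟨T, hT⟩

theorem norm_sqrt_le (q : Param) (n : ℕ) :
    ‖(Real.sqrt (1 - (q : ℝ) ^ (2 * n)) : ℂ)‖ ≤ 1 := by
  rw [Complex.norm_real, Real.norm_of_nonneg (Real.sqrt_nonneg _)]
  refine Real.sqrt_le_one.mpr ?_
  have : 0 ≤ (q : ℝ) ^ (2 * n) := by rw [pow_mul]; positivity
  linarith

theorem norm_pow_le (q : Param) (n : ℕ) : ‖((q : ℝ) : ℂ) ^ n‖ ≤ 1 := by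
  rw [norm_pow, Complex.norm_real]
  exact pow_le_one₀ (norm_nonneg _) q.2.2.le

theorem opA_mem_rightBounded (q : Param) : (⟨opA q, opA_mem q⟩ : CSU q) ∈ rightBounded q := by
  -- Lowering the level only increases the weight, so the constant is `1`. The coefficient `0` at `n
  -- = 0` keeps the truncated value `0 - 1 = 0` out of the support, where it would break
  -- injectivity.
  refine mem_rightBounded_of_basis q _
    (fun n => if n = 0 then 0 else (Real.sqrt (1 - (q : ℝ) ^ (2 * n)) : ℂ)) (fun n => n - 1)
    (fun _ => 0) 1 (fun n => ?_) (fun n => ?_) ?_ (fun n hn => ?_) zero_le_one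
  · change opA q (basisVec n 0) = _
    cases n with
    | zero => rw [opA_basisVec_zero, if_pos rfl, zero_smul]
    | succ n => rw [opA_basisVec_succ, if_neg n.succ_ne_zero, Nat.add_sub_cancel]
  · split_ifs
    · simp
    · exact norm_sqrt_le q n
  · intro i hi j hj h
    simp only [Function.mem_support, ne_eq, ite_eq_left_iff, not_forall] at hi hj h
    obtain ⟨hi, -⟩ := hi
    obtain ⟨hj, -⟩ := hj
    omega
  · rw [one_mul, pow_mul, pow_mul]
    exact pow_le_pow_of_le_one q.sq_pos.le q.sq_lt_one.le (Nat.sub_le n 1)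

theorem opA_star_mem_rightBounded (q : Param) :
    (⟨star (opA q), star_mem (opA_mem q)⟩ : CSU q) ∈ rightBounded q := by
  -- Raising the level by one costs exactly the factor `q⁻²`.
  refine mem_rightBounded_of_basis q _
    (fun n => (Real.sqrt (1 - (q : ℝ) ^ (2 * (n + 1))) : ℂ)) (fun n => n + 1)
    (fun _ => 0) ((q : ℝ) ^ 2)⁻¹ (fun n => ?_) (fun n => norm_sqrt_le q _) ?_ (fun n hn => ?_)
    (by positivity)
  · change (star (opA q) : Hilb →L[ℂ] Hilb) (basisVec n 0) = _
    ext ⟨r, l⟩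
    rw [smul_hilb_apply, basisVec_apply]
    cases r with
    | zero => rw [opA_star_apply_zero]; simp
    | succ r =>
      rw [opA_star_apply_succ, basisVec_apply]
      by_cases h : r = n
      · subst h; simp
      · simp [h]
  · intro i _ j _ h
    simpa using h
  · have := q.sq_pos
    rw [pow_mul, pow_mul, pow_succ _ n, mul_comm _ ((q : ℝ) ^ 2), inv_mul_cancel_left₀ this.ne']

theorem opB_mem_rightBounded (q : Param) : (⟨opB q, opB_mem q⟩ : CSU q) ∈ rightBounded q := by
  refine mem_rightBounded_of_basis q _ (fun n => ((q : ℝ) : ℂ) ^ n) id (fun _ => 1) 1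
    (fun n => ?_) (fun n => norm_pow_le q n) (Set.injOn_id _) (fun n hn => by simp) zero_le_one
  change opB q (basisVec n 0) = _
  rw [opB_basisVec, zero_add, id]

theorem opB_star_mem_rightBounded (q : Param) :
    (⟨star (opB q), star_mem (opB_mem q)⟩ : CSU q) ∈ rightBounded q := by
  refine mem_rightBounded_of_basis q _ (fun n => ((q : ℝ) : ℂ) ^ n) id (fun _ => -1) 1
    (fun n => ?_) (fun n => norm_pow_le q n) (Set.injOn_id _) (fun n hn => by simp) zero_le_one
  change (star (opB q) : Hilb →L[ℂ] Hilb) (basisVec n 0) = _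
  ext ⟨r, l⟩
  rw [smul_hilb_apply, basisVec_apply, opB_star_apply, basisVec_apply]
  by_cases h : r = n
  · subst h; simp [eq_neg_iff_add_eq_zero]
  · simp [h]

/-- `rightBounded` is an algebra but not visibly closed under adjoints, so `a^*` and `b^*` are
treated as separate generators. -/
theorem adjoin_le_rightBounded (q : Param) :
    (StarAlgebra.adjoin ℂ {opA q, opB q}).toSubalgebra ≤
      (rightBounded q).map (rep q).toAlgHom := by
  rw [StarAlgebra.adjoin_toSubalgebra, Algebra.adjoin_le_iff]
  rintro x (hx | hx)
  · rcases hx with rfl | rfl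
    · exact ⟨_, opA_mem_rightBounded q, rfl⟩
    · exact ⟨_, opB_mem_rightBounded q, rfl⟩
  · rw [Set.mem_star] at hx
    rcases hx with hx | hx
    · rw [← star_star x, hx]
      exact ⟨_, opA_star_mem_rightBounded q, rfl⟩
    · rw [← star_star x, Set.mem_singleton_iff.mp hx]
      exact ⟨_, opB_star_mem_rightBounded q, rfl⟩

theorem dense_rightBounded (q : Param) : Dense (rightBounded q : Set (CSU q)) := by
  intro y
  rw [Metric.mem_closure_iff]
  intro ε hε
  have hy : (y.1 : Hilb →L[ℂ] Hilb) ∈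
      closure (StarAlgebra.adjoin ℂ {opA q, opB q} : Set (Hilb →L[ℂ] Hilb)) := y.2
  obtain ⟨b, hb, hyb⟩ := Metric.mem_closure_iff.mp hy ε hε
  obtain ⟨a, ha, rfl⟩ := adjoin_le_rightBounded q hb
  exact ⟨a, ha, hyb⟩

theorem continuous_gnsRep_gnsVec (q : Param) :
    Continuous fun y : CSU q => gnsRep q y (gnsVec q) :=
  (ContinuousLinearMap.apply ℂ (L2 q) (gnsVec q)).continuous.comp (map_continuous (gnsRep q))

/-- The operators in the commutant of the GNS representation act cyclically on the GNS vector. -/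
theorem dense_commutant_gnsVec (q : Param) :
    Dense ((fun T : L2 q →L[ℂ] L2 q => T (gnsVec q)) '' {T | ∀ x, Commute T (gnsRep q x)}) := by
  refine ((denseRange_gnsRep q).dense_image (continuous_gnsRep_gnsVec q)
    (dense_rightBounded q)).mono ?_
  rintro _ ⟨a, ⟨T, hT⟩, rfl⟩
  refine ⟨T, commute_of_rightMul q hT, ?_⟩
  have := hT 1
  rwa [map_one, one_apply_eq_self, one_mul] at this

end QSU2

/-! ### The unitary `w`, the projection `p` and their Haar values. -/

namespace QSU2

theorem matUnit_star (m n : ℕ) : star (matUnit m n) = matUnit n m := by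
  ext x ⟨r, k⟩
  rw [← inner_basisVec, ContinuousLinearMap.star_eq_adjoint,
    ContinuousLinearMap.adjoint_inner_right, matUnit_basisVec, matUnit_apply]
  split_ifs <;> simp [inner_basisVec]

theorem matUnit_mul (m n r s : ℕ) :
    matUnit m n * matUnit r s = if n = r then matUnit m s else 0 := by
  ext x ⟨t, k⟩
  change matUnit m n (matUnit r s x) (t, k) = _
  rw [matUnit_apply, matUnit_apply]
  split_ifs <;> simp_all [matUnit_apply]

theorem rep_injective (q : Param) : Function.Injective (rep q) := Subtype.val_injective

theorem rep_unitE (q : Param) (m n : ℕ) : rep q (unitE q m n) = matUnit m n := rfl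

theorem star_unitE (q : Param) (m n : ℕ) : star (unitE q m n) = unitE q n m :=
  rep_injective q (by rw [map_star, rep_unitE, rep_unitE, matUnit_star])

theorem unitE_mul (q : Param) (m n r s : ℕ) :
    unitE q m n * unitE q r s = if n = r then unitE q m s else 0 :=
  rep_injective q (by
    rw [map_mul, rep_unitE, rep_unitE, matUnit_mul]
    split_ifs
    · rfl
    · rw [map_zero])

theorem star_projP (q : Param) : star (projP q) = projP q := star_unitE q 0 0

theorem projP_mul_self (q : Param) : projP q * projP q = projP q := by
  rw [projP, unitE_mul, if_pos rfl]

theorem unitW_mul_star (q : Param) : unitW q * star (unitW q) = 1 := by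
  simp only [unitW, star_add, star_sub, star_one, star_unitE, mul_add, add_mul, mul_sub, sub_mul,
    mul_one, one_mul, unitE_mul]
  norm_num
  abel

theorem star_unitW_mul (q : Param) : star (unitW q) * unitW q = 1 := by
  simp only [unitW, star_add, star_sub, star_one, star_unitE, mul_add, add_mul, mul_sub, sub_mul,
    mul_one, one_mul, unitE_mul]
  norm_num
  abel

/-- The cyclic permutation `0 ↦ 1 ↦ 2 ↦ 0` of `ℕ`. -/
def cycle (n : ℕ) : ℕ := if n = 0 then 1 else if n = 1 then 2 else if n = 2 then 0 else n

theorem cycle_injective : Function.Injective cycle := by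
  intro i j h
  simp only [cycle] at h
  split_ifs at h <;> omega

theorem rep_star_unitW_basisVec (q : Param) (n : ℕ) :
    rep q (star (unitW q)) (basisVec n 0) = basisVec (cycle n) 0 := by
  simp only [unitW, star_add, star_sub, star_one, star_unitE, map_add, map_sub, map_one, rep_unitE,
    add_apply, sub_apply, one_apply_eq_self, matUnit_basisVec, cycle]
  split_ifs <;> simp_all

/-- The state `φ` is dominated by `q⁻² φ(w^* · w)`: an operator of norm at most `|q|⁻¹` in the
commutant of the GNS representation maps `w ξ` to `ξ`. -/
theorem exists_commutant_unitW (q : Param) : ∃ T : L2 q →L[ℂ] L2 q,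
    (∀ x, Commute T (gnsRep q x)) ∧ T (gnsRep q (unitW q) (gnsVec q)) = gnsVec q ∧
      ‖T‖ ^ 2 ≤ ((q : ℝ) ^ 2)⁻¹ := by
  have hq := q.sq_pos
  -- `cycle n ≤ n + 1`, with equality at `n = 0, 1`; this is the source of the factor `q⁻²`.
  have hC : ∀ n : ℕ, (q : ℝ) ^ (2 * n) ≤ ((q : ℝ) ^ 2)⁻¹ * (q : ℝ) ^ (2 * cycle n) := fun n => by
    rw [le_inv_mul_iff₀ hq, pow_mul, pow_mul, ← pow_succ']
    refine pow_le_pow_of_le_one hq.le q.sq_lt_one.le ?_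
    rw [cycle]
    split_ifs <;> omega
  -- `T` is right multiplication by `w^*`, so `T (w ξ) = w w^* ξ = ξ`.
  obtain ⟨T, hT, hn⟩ := exists_rightMul q (star (unitW q)) ((q : ℝ) ^ 2)⁻¹
    (haar_mul_right_le q _ (fun _ => 1) cycle (fun _ => 0) _
      (fun n => by rw [rep_star_unitW_basisVec, one_smul]) (fun _ => by simp)
      cycle_injective.injOn (fun n _ => hC n) (by positivity))
  refine ⟨T, commute_of_rightMul q hT, ?_, ?_⟩
  · rw [hT, unitW_mul_star, map_one, one_apply_eq_self]
  · calc ‖T‖ ^ 2 ≤ √((q : ℝ) ^ 2)⁻¹ ^ 2 := by gcongr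
      _ = _ := Real.sq_sqrt (by positivity)

theorem haar_projP (q : Param) : haar q (projP q) = ((1 - (q : ℝ) ^ 2 : ℝ) : ℂ) := by
  have h := haar_star_mul_self q (projP q)
  rw [star_projP, projP_mul_self] at h
  rw [h, tsum_eq_single 0]
  · rw [projP, rep_unitE, matUnit_basisVec, if_pos rfl, basisVec_norm]
    simp
  · intro n hn
    rw [projP, rep_unitE, matUnit_basisVec, if_neg hn]
    simp

/-- `w` carries level `1` to level `0`, so only the term `n = 1`, of weight `q²`, survives. This
extra `q²` compensates the normalising factor `q⁻²`. -/
theorem haar_conj_projP (q : Param) :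
    haar q (star (unitW q) * projP q * unitW q)
      = (((1 - (q : ℝ) ^ 2) * (q : ℝ) ^ 2 : ℝ) : ℂ) := by
  have h := haar_star_mul_self q (projP q * unitW q)
  rw [star_mul, star_projP, ← mul_assoc, mul_assoc (star _), projP_mul_self] at h
  have hw : ∀ n, rep q (projP q * unitW q) (basisVec n 0) = if n = 1 then basisVec 0 0 else 0 := by
    intro n
    rw [map_mul, mul_apply_eq_comp, projP, rep_unitE]
    simp only [unitW, map_add, map_sub, map_one, rep_unitE,
      add_apply, sub_apply, one_apply_eq_self, matUnit_basisVec]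
    split_ifs <;> simp_all [matUnit_basisVec]
  rw [h, tsum_eq_single 1]
  · rw [hw, if_pos rfl, basisVec_norm]
    simp
  · intro n hn
    rw [hw, if_neg hn]
    simp

end QSU2

/-! ### Domination by commuting operators and decreasing projections. -/

namespace OpAlg

open scoped ENNReal NNReal Topology

variable {E : Type*} [NormedAddCommGroup E] [InnerProductSpace ℂ E]

theorem tendsto_zero_of_dense_span {S : Set E} (hS : Dense (Submodule.span ℂ S : Set E))
    {α : Type*} {l : Filter α} {d : α → E →L[ℂ] E} (hd : ∀ n, ‖d n‖ ≤ 1)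
    (h : ∀ v ∈ S, Filter.Tendsto (fun n => d n v) l (𝓝 0)) (v : E) :
    Filter.Tendsto (fun n => d n v) l (𝓝 0) := by
  have hspan : ∀ u ∈ Submodule.span ℂ S, Filter.Tendsto (fun n => d n u) l (𝓝 0) := by
    intro u hu
    induction hu using Submodule.span_induction with
    | mem x hx => exact h x hx
    | zero => simpa using tendsto_const_nhds
    | add x y _ _ hx hy => simpa using hx.add hy
    | smul c x _ hx => simpa using hx.const_smul c
  rw [Metric.tendsto_nhds]
  intro ε hε
  obtain ⟨u, hu, huv⟩ := Metric.dense_iff.mp hS v (ε / 2) (half_pos hε)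
  filter_upwards [Metric.tendsto_nhds.mp (hspan u huv) (ε / 2) (half_pos hε)] with n hn
  rw [dist_zero_right] at hn ⊢
  rw [Metric.mem_ball, dist_eq_norm] at hu
  have h1 : ‖d n (u - v)‖ ≤ ‖u - v‖ := by simpa using (d n).le_of_opNorm_le (hd n) (u - v)
  have h2 : d n v = d n u - d n (u - v) := by rw [map_sub]; abel
  rw [h2]
  linarith [norm_sub_le (d n u) (d n (u - v))]

variable [CompleteSpace E]

/-- `x` commutes with `T` and, being self-adjoint, with `T^*`. Hence `x (‖T‖² - T^* T)` is a product
of commuting positive operators. -/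
theorem inner_re_le_of_commute {x T : E →L[ℂ] E} (hx : 0 ≤ x) (hT : Commute x T) (η : E) :
    (⟪T η, x (T η)⟫_ℂ).re ≤ ‖T‖ ^ 2 * (⟪η, x η⟫_ℂ).re := by
  have hT' : Commute x (star T) := by
    simpa [(IsSelfAdjoint.of_nonneg hx).star_eq] using hT.star_star
  have h1 : 0 ≤ x * (algebraMap ℝ (E →L[ℂ] E) (‖T‖ ^ 2) - star T * T) :=
    Commute.mul_nonneg hx (sub_nonneg.mpr CStarAlgebra.star_mul_le_algebraMap_norm_sq)
      ((Algebra.commute_algebraMap_right _ x).sub_right (hT'.mul_right hT))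
  have h2 : ⟪η, (x * (star T * T)) η⟫_ℂ = ⟪T η, x (T η)⟫_ℂ := by
    rw [← mul_assoc, hT'.eq, mul_apply_eq_comp, mul_apply_eq_comp,
      ContinuousLinearMap.star_eq_adjoint, ContinuousLinearMap.adjoint_inner_right]
  have h3 := inner_re_nonneg h1 η
  rw [mul_sub, sub_apply, inner_sub_right, h2, mul_apply_eq_comp,
    Algebra.algebraMap_eq_smul_one, smul_apply, one_apply_eq_self,
    ContinuousLinearMap.map_smul_of_tower, ← Complex.coe_smul, inner_smul_right, Complex.sub_re,
    Complex.re_ofReal_mul] at h3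
  linarith

/-- A decreasing sequence of projections converges strongly to a projection. -/
theorem exists_strong_limit_of_antitone {P : ℕ → E →L[ℂ] E} (hP : ∀ m, IsStarProjection (P m))
    (hanti : Antitone P) : ∃ s : E →L[ℂ] E, IsStarProjection s ∧ (∀ m, s ≤ P m) ∧
      ∀ η, Filter.Tendsto (fun m => P m η) Filter.atTop (𝓝 (s η)) := by
  obtain ⟨z, hz⟩ := exists_strong_limit (y := fun m => 1 - P m) (B := 1)
    (fun i j hij => sub_le_sub_left (hanti hij) 1) (fun m => (hP m).one_sub_nonneg)
    (fun m => (hP m).one_sub.le_one)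
  have hs : ∀ η, Filter.Tendsto (fun m => P m η) Filter.atTop (𝓝 ((1 - z) η)) := fun η =>
    ((tendsto_const_nhds (x := η)).sub (hz η)).congr fun m => by simp
  have hsa : IsSelfAdjoint (1 - z) :=
    isSelfAdjoint_of_strong_limit (fun m => (hP m).isSelfAdjoint) hs
  -- The limit of `P m * P j = P j` as `j → ∞`. It gives the bound `1 - z ≤ P m`, and a second limit
  -- in `m` gives idempotence.
  have hmul : ∀ m, P m * (1 - z) = 1 - z := fun m => by
    ext η
    refine tendsto_nhds_unique (((P m).continuous.tendsto _).comp (hs η)) ((hs η).congr' ?_)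
    filter_upwards [Filter.Ici_mem_atTop m] with j hj
    exact (DFunLike.congr_fun (((hP j).le_iff_mul_eq_right (hP m)).mp (hanti hj)) η).symm
  have hidem : (1 - z) * (1 - z) = 1 - z := by
    ext η
    refine tendsto_nhds_unique (hs ((1 - z) η)) (tendsto_const_nhds.congr fun m => ?_)
    exact (DFunLike.congr_fun (hmul m) η).symm
  have hproj : IsStarProjection (1 - z) := ⟨hidem, hsa⟩
  exact ⟨1 - z, hproj, fun m => (hproj.le_iff_mul_eq_right (hP m)).mpr (hmul m), hs⟩

end OpAlg

/-! ### Monotonicity, weight property, normality, faithfulness and infiniteness. -/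

namespace QSU2

open scoped ENNReal NNReal Topology
open InfTensor OpAlg

variable (q : ℕ → Param)

theorem legRep_mem (k : ℕ) (x : CSU (q k)) : legRep q k x ∈ LInf q := by
  change _ ∈ StarSubalgebra.centralizer ℂ _
  rw [StarSubalgebra.mem_centralizer_iff]
  intro g hg
  have hg' := star_mem hg
  rw [SetLike.mem_coe, StarSubalgebra.mem_centralizer_iff] at hg
  rw [StarSubalgebra.mem_centralizer_iff] at hg'
  exact ⟨((hg _ ⟨k, x, rfl⟩).1).symm, ((hg' _ ⟨k, x, rfl⟩).1).symm⟩

theorem legRep_star (k : ℕ) (x : CSU (q k)) : legRep q k (star x) = star (legRep q k x) := by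
  rw [legRep, legRep, map_star, leg_star]

theorem legRep_mul (k : ℕ) (x y : CSU (q k)) :
    legRep q k (x * y) = legRep q k x * legRep q k y := by
  rw [legRep, legRep, legRep, map_mul, leg_mul]

theorem legRep_one (k : ℕ) : legRep q k 1 = 1 := by rw [legRep, map_one, leg_one]

theorem legRep_commute {j k : ℕ} (h : j ≠ k) (x : CSU (q j)) (y : CSU (q k)) :
    Commute (legRep q j x) (legRep q k y) :=
  leg_commute_of_ne _ h _ _

/-- Operators commuting with the GNS representation in one leg lie in the commutant. -/
theorem commute_leg_of_mem {k : ℕ} {T : L2 (q k) →L[ℂ] L2 (q k)}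
    (hT : ∀ x, Commute T (gnsRep (q k) x)) {y : L2Inf q →L[ℂ] L2Inf q} (hy : y ∈ LInf q) :
    Commute y (leg (fun k => gnsVec_norm (q k)) k T) := by
  have hcomm : ∀ (j : ℕ) (x : CSU (q j)),
      Commute (legRep q j x) (leg (fun k => gnsVec_norm (q k)) k T) := by
    intro j x
    by_cases h : j = k
    · subst h
      exact leg_commute_of_commute _ j (hT x).symm
    · exact leg_commute_of_ne _ h _ _
  have hmem : leg (fun k => gnsVec_norm (q k)) k T ∈
      StarSubalgebra.centralizer ℂ {T | ∃ (k : ℕ) (x : CSU (q k)), T = legRep q k x} := by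
    rw [StarSubalgebra.mem_centralizer_iff]
    rintro _ ⟨j, x, rfl⟩
    rw [← legRep_star]
    exact ⟨hcomm j x, hcomm j _⟩
  change y ∈ StarSubalgebra.centralizer ℂ _ at hy
  rw [StarSubalgebra.mem_centralizer_iff] at hy
  exact (hy _ hmem).1.symm

/-- The vector implementing `twistedState`. -/
noncomputable def twistedTensor (n : ℕ) : L2Inf q :=
  tprod (fun k => gnsVec_norm (q k)) (twistedVec q n)

theorem rescaled_eq (n : ℕ) (x : PosCone (LInf q)) :
    rescaled q n x = ENNReal.ofReal (∏ k ∈ Finset.range n, ((q k : ℝ) ^ 2)⁻¹) *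
      ENNReal.ofReal (⟪twistedTensor q n, x.1 (twistedTensor q n)⟫_ℂ).re :=
  ENNReal.ofReal_mul (Finset.prod_nonneg fun k _ => by positivity)

/-- The operator of `exists_commutant_unitW` in leg `n` commutes with `M` and maps the vector for `n
+ 1` to the vector for `n`. Its squared norm is absorbed by the new factor `q_n⁻²`. -/
theorem rescaled_le_succ (n : ℕ) (x : PosCone (LInf q)) :
    rescaled q n x ≤ rescaled q (n + 1) x := by
  obtain ⟨T, hT, hTw, hTn⟩ := exists_commutant_unitW (q n)
  have hact : (twistedVec q (n + 1)).act n T = twistedVec q n := Elem.ext fun k => by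
    by_cases h : k = n
    · subst h
      rw [Elem.act_same]
      simp only [twistedVec, lt_add_iff_pos_right, Nat.lt_one_iff, pos_of_gt, if_true, lt_irrefl,
        if_false]
      exact hTw
    · rw [Elem.act_ne _ _ _ h]
      have : k < n + 1 ↔ k < n := by omega
      simp only [twistedVec, this]
  have hvec : leg (fun k => gnsVec_norm (q k)) n T (twistedTensor q (n + 1))
      = twistedTensor q n := by
    rw [twistedTensor, leg_tprod, hact, twistedTensor]
  have h := inner_re_le_of_commute x.2.2 (commute_leg_of_mem q hT x.2.1) (twistedTensor q (n + 1))
  rw [hvec] at h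
  refine ENNReal.ofReal_le_ofReal ?_
  rw [Finset.prod_range_succ, mul_assoc]
  refine mul_le_mul_of_nonneg_left (h.trans ?_) (Finset.prod_nonneg fun k _ => by positivity)
  refine mul_le_mul_of_nonneg_right (le_trans ?_ hTn) (inner_re_nonneg x.2.2 _)
  gcongr
  exact norm_leg_le _ _ _

theorem monotone_rescaled (x : PosCone (LInf q)) : Monotone fun n => rescaled q n x :=
  monotone_nat_of_le_succ fun n => rescaled_le_succ q n x

theorem isWeight_weightOmega : IsWeight (weightOmega q) where
  map_add x y z h := by
    -- Suprema add only because both sequences are increasing.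
    rw [weightOmega, weightOmega, weightOmega,
      ENNReal.iSup_add_iSup_of_monotone (monotone_rescaled q x) (monotone_rescaled q y)]
    refine iSup_congr fun n => ?_
    rw [rescaled_eq, rescaled_eq, rescaled_eq, ← mul_add,
      ← ENNReal.ofReal_add (inner_re_nonneg x.2.2 _) (inner_re_nonneg y.2.2 _), h, add_apply,
      inner_add_right, Complex.add_re]
  map_smul r x z h := by
    rw [weightOmega, weightOmega, ENNReal.mul_iSup]
    refine iSup_congr fun n => ?_
    rw [rescaled_eq, rescaled_eq, h, smul_apply, inner_smul_right, Complex.re_ofReal_mul,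
      ENNReal.ofReal_mul r.coe_nonneg, ENNReal.ofReal_coe_nnreal, mul_left_comm]

theorem isNormal_weightOmega : IsNormal (weightOmega q) := by
  have h : weightOmega q = fun x => ⨆ n, ENNReal.ofReal (∏ k ∈ Finset.range n, ((q k : ℝ) ^ 2)⁻¹) *
      ENNReal.ofReal (⟪twistedTensor q n, x.1 (twistedTensor q n)⟫_ℂ).re :=
    funext fun x => iSup_congr fun n => rescaled_eq q n x
  rw [h]
  exact IsNormal.iSup fun n => (isNormal_vector (twistedTensor q n)).const_mul _

theorem weightOmega_mono {x y : PosCone (LInf q)} (h : x.1 ≤ y.1) :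
    weightOmega q x ≤ weightOmega q y := by
  refine iSup_mono fun n => ?_
  rw [rescaled_eq, rescaled_eq]
  exact mul_le_mul_right (ENNReal.ofReal_le_ofReal (inner_re_mono h _)) _

/-- The term `n = 0` suffices: its vector `⊗ ξ_k` is cyclic for the commutant of `M`, hence
separating for `M`. -/
theorem isFaithful_weightOmega : IsFaithful (weightOmega q) := by
  intro x hx
  have h0 : rescaled q 0 x = 0 := le_antisymm ((le_iSup (fun n => rescaled q n x) 0).trans hx.le)
    zero_le
  rw [rescaled_eq, Finset.range_zero, Finset.prod_empty, ENNReal.ofReal_one, one_mul,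
    ENNReal.ofReal_eq_zero] at h0
  refine eq_zero_of_commute_leg _ (fun i => {T | ∀ y, Commute T (gnsRep (q i) y)})
    (fun i => dense_commutant_gnsVec (q i)) (fun i T hT => commute_leg_of_mem q hT x.2.1)
    (twistedVec q 0) (fun i => by simp [twistedVec]) ?_
  exact apply_eq_zero_of_inner_eq_zero x.2.2 (le_antisymm h0 (inner_re_nonneg x.2.2 _))

theorem finTensor_one (n m : ℕ) : finTensor q (fun _ => 1) n m = 1 := by
  rw [finTensor]
  refine List.prod_eq_one fun y hy => ?_
  obtain ⟨j, -, rfl⟩ := List.mem_map.mp hy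
  exact legRep_one q _

theorem twistedState_one (n : ℕ) : twistedState q n 1 = 1 := by
  have h := twistedState_finTensor q (fun _ => 1) n n le_rfl
  rw [finTensor_one] at h
  rw [h]
  simp [star_unitW_mul, haar_one]

/-- At `1` the `n`-th functional equals `∏_{k<n} q_k⁻²`, and `q_k² → 0` by summability. -/
theorem not_isFinite_weightOmega (hq : Summable fun k => (q k : ℝ) ^ 2) :
    ¬ IsFinite (weightOmega q) := by
  intro hfin
  have h1 := hfin ⟨1, one_mem _, zero_le_one⟩
  have hge : ∀ n, ENNReal.ofReal (∏ k ∈ Finset.range n, ((q k : ℝ) ^ 2)⁻¹)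
      ≤ weightOmega q ⟨1, one_mem _, zero_le_one⟩ := fun n => by
    refine le_trans (le_of_eq ?_) (le_iSup (fun n => rescaled q n _) n)
    simp only [rescaled]
    rw [twistedState_one, Complex.one_re, mul_one]
  have htend : Filter.Tendsto (fun n => ∏ k ∈ Finset.range n, ((q k : ℝ) ^ 2)⁻¹) Filter.atTop
      Filter.atTop := by
    have hinv : Filter.Tendsto (fun k => ((q k : ℝ) ^ 2)⁻¹) Filter.atTop Filter.atTop := by
      refine Filter.Tendsto.inv_tendsto_nhdsGT_zero (tendsto_nhdsWithin_iff.mpr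
        ⟨hq.tendsto_atTop_zero, Filter.Eventually.of_forall fun k => (q k).sq_pos⟩)
    -- After the shift the product over `range (n + 1)` is at least its last factor `q_n⁻²`, the
    -- others being at least `1`.
    rw [← Filter.tendsto_add_atTop_iff_nat 1]
    refine Filter.tendsto_atTop_mono (fun n => ?_) hinv
    rw [Finset.prod_range_succ]
    refine le_mul_of_one_le_left (inv_nonneg.mpr (q n).sq_pos.le) ?_
    exact Finset.one_le_prod fun k _ => (one_le_inv₀ (q k).sq_pos).mpr (q k).sq_lt_one.le
  have h2 := ENNReal.tendsto_ofReal_atTop.comp htend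
  exact h1.ne (top_le_iff.mp (le_of_tendsto h2 (Filter.Eventually.of_forall hge)))

end QSU2

/-! ### The infinite tensor products of the `p_k` and semi-finiteness. -/

namespace QSU2

open scoped ENNReal NNReal Topology
open InfTensor OpAlg

variable (q : ℕ → Param)

theorem finTensor_succ (x : ∀ k, CSU (q k)) (n m : ℕ) :
    finTensor q x n (m + 1) = finTensor q x n m * legRep q (n + m) (x (n + m)) := by
  rw [finTensor, finTensor, List.range_succ, List.map_append, List.prod_append, List.map_singleton,
    List.prod_singleton]

theorem finTensor_zero (x : ∀ k, CSU (q k)) (n : ℕ) : finTensor q x n 0 = 1 := rfl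

theorem finTensor_mem (x : ∀ k, CSU (q k)) (n m : ℕ) : finTensor q x n m ∈ LInf q := by
  induction m with
  | zero => exact one_mem _
  | succ m ih =>
    rw [finTensor_succ]
    exact mul_mem ih (legRep_mem q _ _)

theorem finTensor_commute (x : ∀ k, CSU (q k)) (n : ℕ) {m k : ℕ} (h : n + m ≤ k) (y : CSU (q k)) :
    Commute (finTensor q x n m) (legRep q k y) := by
  induction m with
  | zero => exact Commute.one_left _
  | succ m ih =>
    rw [finTensor_succ]
    exact (ih (by omega)).mul_left (legRep_commute q (by omega) _ _)

theorem isStarProjection_legRep (k : ℕ) : IsStarProjection (legRep q k (projP (q k))) :=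
  ⟨by rw [IsIdempotentElem, ← legRep_mul, projP_mul_self],
    by rw [IsSelfAdjoint, ← legRep_star, star_projP]⟩

theorem isStarProjection_finTensor (n m : ℕ) :
    IsStarProjection (finTensor q (fun k => projP (q k)) n m) := by
  induction m with
  | zero => exact IsStarProjection.one _
  | succ m ih =>
    rw [finTensor_succ]
    have hc := finTensor_commute q (fun k => projP (q k)) n le_rfl (projP (q (n + m)))
    have hp := isStarProjection_legRep q (n + m)
    exact ⟨ih.isIdempotentElem.mul_of_commute hc hp.isIdempotentElem,
      (ih.isSelfAdjoint.commute_iff hp.isSelfAdjoint).mp hc⟩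

theorem antitone_finTensor (n : ℕ) : Antitone fun m => finTensor q (fun k => projP (q k)) n m := by
  refine antitone_nat_of_succ_le fun m => ?_
  refine ((isStarProjection_finTensor q n (m + 1)).le_iff_mul_eq_right
    (isStarProjection_finTensor q n m)).mpr ?_
  rw [finTensor_succ, ← mul_assoc, (isStarProjection_finTensor q n m).isIdempotentElem.eq]

/-- `1 - ⊗ p_k ≤ ∑ (1 - p_k)`. -/
theorem one_sub_finTensor_le (n m : ℕ) : 1 - finTensor q (fun k => projP (q k)) n m
    ≤ ∑ j ∈ Finset.range m, (1 - legRep q (n + j) (projP (q (n + j)))) := by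
  induction m with
  | zero => simp [finTensor_zero]
  | succ m ih =>
    rw [Finset.sum_range_succ, finTensor_succ]
    set P := finTensor q (fun k => projP (q k)) n m with hPdef
    set e := legRep q (n + m) (projP (q (n + m)))
    have hc : Commute P e := finTensor_commute q _ n le_rfl _
    -- Expanding this product of commuting projections gives `1 - P e ≤ (1 - P) + (1 - e)`, a union
    -- bound.
    have h : 0 ≤ (1 - P) * (1 - e) :=
      Commute.mul_nonneg (isStarProjection_finTensor q n m).one_sub_nonneg
        (isStarProjection_legRep q (n + m)).one_sub_nonneg
        (((Commute.one_left _).sub_left ((Commute.one_right P).sub_right hc)))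
    have h2 : (1 - P) + (1 - e) - (1 - P * e) = (1 - P) * (1 - e) := by noncomm_ring
    calc 1 - P * e ≤ (1 - P) + (1 - e) := sub_nonneg.mp (h2 ▸ h)
      _ ≤ _ := add_le_add_left ih _

/-- Leg `k` of `v` is `ξ_k`, so the expectation is `‖v‖² φ_k(1 - p_k)`, and `φ_k(1 - p_k) = q_k²`.
-/
theorem inner_tprod_one_sub_legRep (v : Elem fun k => gnsVec (q k)) {k : ℕ}
    (hk : v.1 k = gnsVec (q k)) :
    (⟪tprod (fun k => gnsVec_norm (q k)) v, (1 - legRep q k (projP (q k)))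
      (tprod (fun k => gnsVec_norm (q k)) v)⟫_ℂ).re
      = ‖tprod (fun k => gnsVec_norm (q k)) v‖ ^ 2 * (q k : ℝ) ^ 2 := by
  obtain ⟨c, hc⟩ := inner_tprod_update (fun k => gnsVec_norm (q k)) v k
  have h1 : v.update k (gnsVec (q k)) = v := Elem.ext fun j => by
    by_cases h : j = k
    · subst h; rw [Elem.update_same, hk]
    · rw [Elem.update_ne _ _ _ h]
  have h2 : v.act k (gnsRep (q k) (projP (q k)))
      = v.update k (gnsRep (q k) (projP (q k)) (gnsVec (q k))) := by rw [Elem.act, hk]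
  have h3 : ⟪gnsVec (q k), gnsRep (q k) (projP (q k)) (gnsVec (q k))⟫_ℂ
      = ((1 - (q k : ℝ) ^ 2 : ℝ) : ℂ) := by
    have := inner_gnsRep (q k) 1 (projP (q k))
    rwa [map_one, one_apply_eq_self, star_one, one_mul, haar_projP] at this
  have h4 : ⟪gnsVec (q k), gnsVec (q k)⟫_ℂ = 1 := by
    rw [inner_self_eq_norm_sq_to_K, gnsVec_norm]; simp
  have h5 := hc (gnsVec (q k)) (gnsVec (q k))
  have h6 := hc (gnsVec (q k)) (gnsRep (q k) (projP (q k)) (gnsVec (q k)))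
  rw [h1, h4, mul_one, inner_self_eq_norm_sq_to_K] at h5
  rw [h1, h3, ← h5, ← h2] at h6
  rw [sub_apply, one_apply_eq_self, inner_sub_right, inner_self_eq_norm_sq_to_K, legRep, leg_tprod,
    h6, RCLike.ofReal_eq_complex_ofReal, ← Complex.ofReal_pow, ← Complex.ofReal_mul,
    ← Complex.ofReal_sub, Complex.ofReal_re]
  ring

theorem finTensor_append (x : ∀ k, CSU (q k)) (n m : ℕ) :
    finTensor q x 0 (n + m) = finTensor q x 0 n * finTensor q x n m := by
  induction m with
  | zero => rw [finTensor_zero, mul_one, add_zero]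
  | succ m ih =>
    have h : legRep q (0 + (n + m)) (x (0 + (n + m))) = legRep q (n + m) (x (n + m)) := by
      rw [zero_add]
    rw [← add_assoc, finTensor_succ, ih, h, finTensor_succ, mul_assoc]

theorem finTensor_congr {x y : ∀ k, CSU (q k)} {n m : ℕ}
    (h : ∀ k, n ≤ k → k < n + m → x k = y k) : finTensor q x n m = finTensor q y n m := by
  rw [finTensor, finTensor]
  congr 1
  refine List.map_congr_left fun j hj => ?_
  rw [List.mem_range] at hj
  rw [h (n + j) (by omega) (by omega)]

theorem twistedState_projP (n m : ℕ) :
    twistedState q (n + m) (finTensor q (fun k => projP (q k)) n m)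
      = ((∏ k ∈ Finset.Ico n (n + m), ((1 - (q k : ℝ) ^ 2) * (q k : ℝ) ^ 2) : ℝ) : ℂ) := by
  -- The first `n` legs are padded with `1` so that the product starts at leg `0`; they contribute
  -- `φ_k(w_k^* w_k) = 1`.
  have h := twistedState_finTensor q (fun k => if k < n then 1 else projP (q k)) (n + m) (n + m)
    le_rfl
  have h1 : finTensor q (fun k => if k < n then 1 else projP (q k)) 0 n = 1 := by
    rw [finTensor_congr q (y := fun _ => 1) fun k _ hk => if_pos (by omega), finTensor_one]
  have h2 : finTensor q (fun k => if k < n then 1 else projP (q k)) n m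
      = finTensor q (fun k => projP (q k)) n m :=
    finTensor_congr q fun k hk _ => if_neg (by omega)
  rw [finTensor_append, h1, h2, one_mul, Finset.Ico_self, Finset.prod_empty, mul_one,
    ← Finset.prod_range_mul_prod_Ico _ (Nat.le_add_right n m)] at h
  rw [h, Finset.prod_eq_one, one_mul, Complex.ofReal_prod]
  · refine Finset.prod_congr rfl fun k hk => ?_
    rw [if_neg (by have := Finset.mem_Ico.mp hk; omega), haar_conj_projP]
  · intro k hk
    rw [if_pos (Finset.mem_range.mp hk), mul_one, star_unitW_mul, haar_one]

/-- Each leg `k ≥ n` contributes `q_k⁻² (1 - q_k²) q_k² ≤ 1`, so the prefactor of the first `n` legs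
bounds all terms. -/
theorem weightOmega_lt_top_of_le {n : ℕ} {s : PosCone (LInf q)}
    (hs : ∀ m, s.1 ≤ finTensor q (fun k => projP (q k)) n m) : weightOmega q s < ⊤ := by
  refine lt_of_le_of_lt (iSup_le fun N => ?_)
    (ENNReal.ofReal_lt_top (r := ∏ k ∈ Finset.range n, ((q k : ℝ) ^ 2)⁻¹))
  -- By monotonicity the index may be raised to `n + N`, where exactly the `N` legs after the first
  -- `n` carry a `p_k` to pair with `w_k`.
  refine (monotone_rescaled q s (Nat.le_add_left N n)).trans (ENNReal.ofReal_le_ofReal ?_)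
  have h1 : (twistedState q (n + N) s.1).re
      ≤ ∏ k ∈ Finset.Ico n (n + N), ((1 - (q k : ℝ) ^ 2) * (q k : ℝ) ^ 2) := by
    refine (inner_re_mono (hs N) (twistedTensor q (n + N))).trans_eq ?_
    exact congrArg Complex.re (twistedState_projP q n N)
  refine (mul_le_mul_of_nonneg_left h1 (Finset.prod_nonneg fun k _ => by positivity)).trans ?_
  rw [← Finset.prod_range_mul_prod_Ico _ (Nat.le_add_right n N), mul_assoc,
    ← Finset.prod_mul_distrib]
  refine mul_le_of_le_one_right (Finset.prod_nonneg fun k _ => by positivity)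
    (Finset.prod_le_one (fun k _ => ?_) fun k _ => ?_)
  · have := (q k).sq_lt_one
    have := (q k).sq_pos
    exact mul_nonneg (by positivity) (mul_nonneg (by linarith) this.le)
  · rw [mul_comm (1 - _), inv_mul_cancel_left₀ (q k).sq_pos.ne']
    linarith [(q k).sq_pos]

/-- On an elementary tensor `v` with entries `ξ_k` for `k > n₀`, the union bound yields `‖(1 - s_n)
v‖² ≤ ‖v‖² ∑_{k≥n} q_k²` for `n > n₀`, the tail of a convergent series. Contractivity extends the
limit to all vectors. -/
theorem tendsto_infinite_projP (hq : Summable fun k => (q k : ℝ) ^ 2)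
    {s : ℕ → L2Inf q →L[ℂ] L2Inf q} (hproj : ∀ n, IsStarProjection (s n))
    (hlim : ∀ n η, Filter.Tendsto (fun m => finTensor q (fun k => projP (q k)) n m η) Filter.atTop
      (𝓝 (s n η))) (η : L2Inf q) : Filter.Tendsto (fun n => s n η) Filter.atTop (𝓝 η) := by
  have key : Filter.Tendsto (fun n => (1 - s n) η) Filter.atTop (𝓝 0) := by
    refine tendsto_zero_of_dense_span (dense_span_tprod fun k => gnsVec_norm (q k))
      (fun n => (hproj n).one_sub.norm_le) ?_ η
    rintro _ ⟨v, rfl⟩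
    set t := tprod (fun k => gnsVec_norm (q k)) v with ht
    obtain ⟨n₀, hn₀⟩ := v.2.bddAbove
    have hv : ∀ k, n₀ < k → v.1 k = gnsVec (q k) := fun k hk => by
      by_contra h
      exact absurd (hn₀ h) (not_le.mpr hk)
    have hbound : ∀ n, n₀ < n →
        ‖(1 - s n) t‖ ^ 2 ≤ ‖t‖ ^ 2 * ∑' k, (q (k + n) : ℝ) ^ 2 := by
      intro n hn
      have hsum : Summable fun k => (q (k + n) : ℝ) ^ 2 := (summable_nat_add_iff n).mpr hq
      have h1 : ‖(1 - s n) t‖ ^ 2 ≤ (⟪t, (1 - s n) t⟫_ℂ).re :=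
        (norm_apply_sq_le (hproj n).one_sub_nonneg t).trans (mul_le_of_le_one_left
          (inner_re_nonneg (hproj n).one_sub_nonneg t) (hproj n).one_sub.norm_le)
      refine h1.trans (le_of_tendsto (tendsto_inner_re (y := fun m =>
        1 - finTensor q (fun k => projP (q k)) n m) (l := Filter.atTop) (fun ζ =>
          (tendsto_const_nhds.sub (hlim n ζ))) t) (Filter.Eventually.of_forall fun m => ?_))
      refine (inner_re_mono (one_sub_finTensor_le q n m) t).trans ?_
      rw [sum_apply, inner_sum, Complex.re_sum]
      calc ∑ j ∈ Finset.range m, (⟪t, (1 - legRep q (n + j) (projP (q (n + j)))) t⟫_ℂ).re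
          = ∑ j ∈ Finset.range m, ‖t‖ ^ 2 * (q (j + n) : ℝ) ^ 2 :=
            Finset.sum_congr rfl fun j _ => by
              rw [inner_tprod_one_sub_legRep q v (hv (n + j) (by omega)), add_comm n j]
        _ = ‖t‖ ^ 2 * ∑ j ∈ Finset.range m, (q (j + n) : ℝ) ^ 2 := by rw [Finset.mul_sum]
        _ ≤ _ := by
            gcongr
            exact hsum.sum_le_tsum _ fun k _ => sq_nonneg _
    rw [tendsto_zero_iff_norm_tendsto_zero]
    have hsq : Filter.Tendsto (fun n => √(‖t‖ ^ 2 * ∑' k, (q (k + n) : ℝ) ^ 2)) Filter.atTop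
        (𝓝 0) := by
      have := ((tendsto_sum_nat_add fun k => (q k : ℝ) ^ 2).const_mul (‖t‖ ^ 2)).sqrt
      simpa using this
    refine squeeze_zero' (Filter.Eventually.of_forall fun _ => norm_nonneg _) ?_ hsq
    filter_upwards [Filter.Ioi_mem_atTop n₀] with n hn
    exact Real.le_sqrt_of_sq_le (hbound n hn)
  have h := (tendsto_const_nhds (x := η)).sub key
  simpa using h

/-- From `x ≤ ‖x‖` follows `s_n x s_n ≤ ‖x‖ s_n`, so each compression has weight at most `‖x‖
φ_Ω(s_n) < ∞`. -/
theorem isSemifinite_weightOmega {s : ℕ → PosCone (LInf q)}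
    (hproj : ∀ n, IsStarProjection (s n).1)
    (hfin : ∀ n, weightOmega q (s n) < ⊤)
    (hlim : ∀ η, Filter.Tendsto (fun n => (s n).1 η) Filter.atTop (𝓝 η)) :
    IsSemifinite (weightOmega q) := by
  refine isSemifinite_of_compress (fun n => (hproj n).isSelfAdjoint) (fun n => (hproj n).norm_le)
    hlim fun n x => ?_
  have hsa := (hproj n).isSelfAdjoint
  refine ⟨⟨(s n).1 * x.1 * (s n).1, mul_mem (mul_mem (s n).2.1 x.2.1) (s n).2.1,
    hsa.conjugate_nonneg x.2.2⟩, rfl, ?_⟩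
  let z : PosCone (LInf q) := ⟨((‖x.1‖ : ℝ) : ℂ) • (s n).1,
    (LInf q).toStarSubalgebra.smul_mem (s n).2.1 _,
    smul_nonneg (Complex.zero_le_real.mpr (norm_nonneg _)) (s n).2.2⟩
  refine (weightOmega_mono q (y := z) ?_).trans_lt ?_
  · have h := hsa.conjugate_le_conjugate (IsSelfAdjoint.of_nonneg x.2.2).le_algebraMap_norm_self
    rw [Algebra.algebraMap_eq_smul_one, mul_smul_comm, mul_one, smul_mul_assoc,
      (hproj n).isIdempotentElem.eq, ← Complex.coe_smul] at h
    exact h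
  · rw [(isWeight_weightOmega q).map_smul ‖x.1‖₊ (s n) z rfl]
    exact ENNReal.mul_lt_top ENNReal.coe_lt_top (hfin n)

end QSU2

theorem mainTheorem2 (q : ℕ → QSU2.Param) (hq : Summable fun k => (q k : ℝ) ^ 2) :
    (∀ x : OpAlg.PosCone (QSU2.LInf q),
      Monotone (fun n => QSU2.rescaled q n x) ∧
      Filter.Tendsto (fun n => QSU2.rescaled q n x) Filter.atTop
        (nhds (QSU2.weightOmega q x))) ∧
    OpAlg.IsWeight (QSU2.weightOmega q) ∧
    OpAlg.IsNormal (QSU2.weightOmega q) ∧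
    OpAlg.IsFaithful (QSU2.weightOmega q) ∧
    ¬ OpAlg.IsFinite (QSU2.weightOmega q) ∧
    OpAlg.IsSemifinite (QSU2.weightOmega q) ∧
    ∃ s : ℕ → OpAlg.PosCone (QSU2.LInf q),
      (∀ n, IsStarProjection (s n).1) ∧
      (∀ n, OpAlg.SigmaStrongTendsto
        (fun m => QSU2.finTensor q (fun k => QSU2.projP (q k)) n m) Filter.atTop (s n).1) ∧
      (∀ n, QSU2.weightOmega q (s n) < ⊤) ∧
      OpAlg.SigmaStrongTendsto (fun n => (s n).1) Filter.atTop 1 := by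
  choose p hp hle hlim using fun n => OpAlg.exists_strong_limit_of_antitone
    (QSU2.isStarProjection_finTensor q n) (QSU2.antitone_finTensor q n)
  let s : ℕ → OpAlg.PosCone (QSU2.LInf q) := fun n =>
    ⟨p n, OpAlg.mem_of_strong_limit _ (QSU2.finTensor_mem q _ n) (hlim n), (hp n).nonneg⟩
  have hfin : ∀ n, QSU2.weightOmega q (s n) < ⊤ := fun n =>
    QSU2.weightOmega_lt_top_of_le q (hle n)
  have hone := QSU2.tendsto_infinite_projP q hq hp hlim
  refine ⟨fun x => ⟨QSU2.monotone_rescaled q x,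
    tendsto_atTop_iSup (QSU2.monotone_rescaled q x)⟩, QSU2.isWeight_weightOmega q,
    QSU2.isNormal_weightOmega q, QSU2.isFaithful_weightOmega q,
    QSU2.not_isFinite_weightOmega q hq, QSU2.isSemifinite_weightOmega q (s := s) hp hfin hone,
    s, hp, fun n => ?_, hfin, ?_⟩
  -- Differences of projections are uniformly bounded, which upgrades strong to `σ`-strong
  -- convergence.
  · refine OpAlg.sigmaStrongTendsto_of_strong (C := 1 + 1) (fun m => ?_) (hlim n)
    exact (norm_sub_le _ _).trans
      (add_le_add (QSU2.isStarProjection_finTensor q n m).norm_le (hp n).norm_le)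
  · refine OpAlg.sigmaStrongTendsto_of_strong (C := 1) (fun n => ?_) hone
    rw [norm_sub_rev]
    exact (hp n).one_sub.norm_le
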